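/- **Setting.** Let $K,T\ge 1$ with $KT\ge 2$. In rounds $t=1,\dots,T$ the loss vectors $\ell_t\in[0,1]^K$ are independent random vectors (their distributions may change with $t$, and the coordinates of one vector may be dependent) with means $\mu_t=\mathbb E[\ell_t]$; put $\ell_0=\mu_0=0$. Let $$\Gamma=1+\sum_{t=2}^T \mathbf 1_{\mu_t\ne\mu_{t-1}},\qquad V=\sum_{t=1}^T\|\mu_t-\mu_{t-1}\|_\infty,\qquad \Lambda=\sum_{t=1}^T\mathbb E\big[\|\ell_t-\mu_t\|_2^2\big].$$ In round $t$ the learner draws an arm $a_t$ from a distribution $p_t$ computed from $\ell_1,\dots,\ell_{t-1}$, i.e. $\mathbb P(a_t=k\mid \ell_1,\dots,\ell_t)=p_{t,k}$, and then sees the whole vector $\ell_t$. Its expected dynamic regret is $R_T=\sum_{t=1}^T\big(\mathbb E[\ell_{t,a_t}]-\min_i\mu_{t,i}\big)$. **Optimistic-Adapt-ML-Prod** on a finite set $E$ of experts. Start with $w_{0,e}=1/|E|$. In round $t$, given an estimate vector $m_t$, play $$p_{t,e}=\frac{\eta_{t-1,e}\,w_{t-1,e}\,e^{\eta_{t-1,e}m_{t,e}}}{\sum_{f\in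 E}\eta_{t-1,f}\,w_{t-1,f}\,e^{\eta_{t-1,f}m_{t,f}}}.$$ On receiving a loss vector $\ell_t\in\mathbb R^E$, set $r_{t,e}=\langle p_t,\ell_t\rangle-\ell_{t,e}$ and update $$w_{t,e}=\Big(w_{t-1,e}\,e^{\eta_{t-1,e}r_{t,e}-\eta_{t-1,e}^2(r_{t,e}-m_{t,e})^2}\Big)^{\eta_{t,e}/\eta_{t-1,e}},\qquad \eta_{t,e}=\min\Big\{\tfrac14,\sqrt{\tfrac{\ln|E|}{1+\sum_{s\le t}(r_{s,e}-m_{s,e})^2}}\Big\}\quad(t\ge0).$$ **The parameter-free algorithm** knows $K$ and $T$ but not $\Gamma,V,\Lambda$. It runs Optimistic-Adapt-ML-Prod on the $KT$ experts $(s,k)\in\{1,\dots,T\}\times\{1,\dots,K\}$, where $(s,k)$ is awake in round $t$ if $s\le t$ and asleep otherwise. If $\tilde p_t$ is the distribution of Optimistic-Adapt-ML-Prod on these experts, then $$p_{t,k}=\frac{\sum_{s\le t}\tilde p_{t,(s,k)}}{\sum_{k'=1}^K\sum_{s\le t}\tilde p_{t,(s,k')}}.$$ The estimate $\tilde m_{t,(s,k)}$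 is $\langle p_t,\ell_{t-1}\rangle-\ell_{t-1,k}$ for awake experts and $0$ for sleeping ones. The number $\alpha=\langle p_t,\ell_{t-1}\rangle$ occurring here, on which $p_t$ itself depends through $\tilde m_t$, is the exact solution $\alpha\in[0,1]$ of the resulting fixed-point equation $\langle p_t(\alpha),\ell_{t-1}\rangle=\alpha$, which exists and is unique. The loss fed to $(s,k)$ is $\ell_{t,k}$ if it is awake and $\langle p_t,\ell_t\rangle$ if it is asleep. **Theorem.** There are absolute constants $C>0$ and $d\in\mathbb N$ such that for all $K,T\ge1$ with $KT\ge2$ and all independent loss sequences as above, the expected dynamic regret of the parameter-free algorithm satisfies both $$R_T\le C(1+\ln T)^d\Big(\sqrt{\Gamma\Lambda\ln K}+\Gamma\ln K\Big)$$ and $$R_T\le C(1+\ln T)^d\Big(\sqrt[3]{V\Lambda T\ln K}+\sqrt{VT\ln K}\Big).$$ -/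

import Mathlib

noncomputable section

namespace NonstationaryExperts

/-! ### Optimistic-Adapt-ML-Prod on a finite set `E` of experts -/

/-- The data kept between two rounds: the weight `w_{t,k}` of every expert and the accumulated
squared estimation error `∑_{s ≤ t} (r_{s,k} - m_{s,k})²`, which determines the learning rate. -/
structure ProdState (E : Type*) where
  weight : E → ℝ
  err : E → ℝ

variable {E : Type*} [Fintype E]

/-- The initial state: uniform weights, empty error sums. -/
def ProdState.init (E : Type*) [Fintype E] : ProdState E where
  weight := fun _ => 1 / (Fintype.card E : ℝ)
  err := fun _ => 0

/-- The learning rate `η_{t,k} = min {1/4, √(ln |E| / (1 + ∑_{s ≤ t} (r_{s,k} - m_{s,k})²))}`. -/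
def ProdState.rate (σ : ProdState E) (k : E) : ℝ :=
  min (1 / 4) (Real.sqrt (Real.log (Fintype.card E) / (1 + σ.err k)))

/-- The optimistic weight `w̃_{t-1,k} = w_{t-1,k} exp (η_{t-1,k} m_{t,k})`. -/
def ProdState.optWeight (σ : ProdState E) (m : E → ℝ) (k : E) : ℝ :=
  σ.weight k * Real.exp (σ.rate k * m k)

/-- The distribution `p_{t,k} = η_{t-1,k} w̃_{t-1,k} / ⟨η_{t-1}, w̃_{t-1}⟩` played with the
estimate vector `m`. -/
def ProdState.play (σ : ProdState E) (m : E → ℝ) (k : E) : ℝ :=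
  σ.rate k * σ.optWeight m k / ∑ j, σ.rate j * σ.optWeight m j

/-- The instantaneous regret `r_{t,k} = ⟨p_t, l⟩ - l_k` for the loss vector `l`. -/
def ProdState.instRegret (σ : ProdState E) (m l : E → ℝ) (k : E) : ℝ :=
  (∑ j, σ.play m j * l j) - l k

/-- The error sums after a round with estimate vector `m` and loss vector `l`. -/
def ProdState.newErr (σ : ProdState E) (m l : E → ℝ) (k : E) : ℝ :=
  σ.err k + (σ.instRegret m l k - m k) ^ 2

/-- The learning rate after a round with estimate vector `m` and loss vector `l`. -/
def ProdState.newRate (σ : ProdState E) (m l : E → ℝ) (k : E) : ℝ :=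
  ProdState.rate ⟨σ.weight, σ.newErr m l⟩ k

/-- The update after a round with estimate vector `m` and loss vector `l`:
`w_{t,k} = (w_{t-1,k} exp (η_{t-1,k} r_{t,k} - η_{t-1,k}² (r_{t,k} - m_{t,k})²)) ^ (η_{t,k} / η_{t-1,k})`. -/
def ProdState.update (σ : ProdState E) (m l : E → ℝ) : ProdState E where
  weight := fun k =>
    (σ.weight k * Real.exp (σ.rate k * σ.instRegret m l k
        - σ.rate k ^ 2 * (σ.instRegret m l k - m k) ^ 2)) ^ (σ.newRate m l k / σ.rate k)
  err := σ.newErr m l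

/-! ### The parameter-free algorithm: running it on `K T` sleeping experts

The sleeping expert `(s, k) : Fin T × Fin K` starts in round `s + 1`. -/

variable {T K : ℕ}

/-- Expert `(s, k)` is awake in round `t` (rounds are numbered `1, …, T`). -/
def Awake (t : ℕ) (e : Fin T × Fin K) : Prop := (e.1 : ℕ) + 1 ≤ t

instance (t : ℕ) (e : Fin T × Fin K) : Decidable (Awake t e) := by
  unfold Awake; infer_instance

/-- `m̃_{t,(s,k)} = α - ℓ_{t-1,k}` for awake experts and `0` for sleeping ones, where `α` stands for
`⟨p_t, ℓ_{t-1}⟩` and `prev` for `ℓ_{t-1}`. -/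
def estimate (t : ℕ) (prev : Fin K → ℝ) (α : ℝ) (e : Fin T × Fin K) : ℝ :=
  if Awake t e then α - prev e.2 else 0

/-- The distribution over arms obtained from a distribution over the sleeping experts by
restricting it to the awake ones and normalizing. -/
def armDist (t : ℕ) (q : Fin T × Fin K → ℝ) (k : Fin K) : ℝ :=
  (∑ s : Fin T, if Awake t (s, k) then q (s, k) else 0) /
    ∑ k' : Fin K, ∑ s : Fin T, if Awake t (s, k') then q (s, k') else 0

/-- `⟨p_t(α), ℓ_{t-1}⟩`, where `p_t(α)` is the distribution over arms that results when `α` is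
used in place of `⟨p_t, ℓ_{t-1}⟩` in the estimates. -/
def predictedLoss (t : ℕ) (prev : Fin K → ℝ) (σ : ProdState (Fin T × Fin K)) (α : ℝ) : ℝ :=
  ∑ k, armDist t (σ.play (estimate t prev α)) k * prev k

/-- The value of `⟨p_t, ℓ_{t-1}⟩`: the solution `α ∈ [0, 1]` of `⟨p_t(α), ℓ_{t-1}⟩ = α`. It exists
by continuity, and it is unique since the left side is a contraction in `α` (the learning rates
are at most `1 / 4`), so that the infimum only serves to name it. -/
def fixedPoint (t : ℕ) (prev : Fin K → ℝ) (σ : ProdState (Fin T × Fin K)) : ℝ :=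
  sInf {α : ℝ | α ∈ Set.Icc (0 : ℝ) 1 ∧ predictedLoss t prev σ α = α}

/-- The estimate vector `m̃_t` used in round `t`. -/
def roundEstimate (t : ℕ) (prev : Fin K → ℝ) (σ : ProdState (Fin T × Fin K)) :
    Fin T × Fin K → ℝ :=
  estimate t prev (fixedPoint t prev σ)

/-- The distribution `p_t` over the arms played in round `t`. -/
def roundDist (t : ℕ) (prev : Fin K → ℝ) (σ : ProdState (Fin T × Fin K)) : Fin K → ℝ :=
  armDist t (σ.play (roundEstimate t prev σ))

/-- The modified loss vector `ℓ̃_t`: awake experts get the loss of their arm, sleeping ones the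
expected loss `⟨p_t, ℓ_t⟩`. -/
def roundLoss (t : ℕ) (prev cur : Fin K → ℝ) (σ : ProdState (Fin T × Fin K))
    (e : Fin T × Fin K) : ℝ :=
  if Awake t e then cur e.2 else ∑ k, roundDist t prev σ k * cur k

/-- The loss vector of round `t`, with the convention `ℓ_0 = 0`. -/
def lossAt (l : ℕ → Fin K → ℝ) : ℕ → Fin K → ℝ
  | 0 => 0
  | t + 1 => l (t + 1)

/-- The state after `t` rounds on the loss sequence `l 1, l 2, …`, for the horizon `T`. -/
def stateAfter (T : ℕ) (l : ℕ → Fin K → ℝ) : ℕ → ProdState (Fin T × Fin K)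
  | 0 => ProdState.init (Fin T × Fin K)
  | t + 1 =>
      (stateAfter T l t).update
        (roundEstimate (t + 1) (lossAt l t) (stateAfter T l t))
        (roundLoss (t + 1) (lossAt l t) (l (t + 1)) (stateAfter T l t))

/-- The distribution `p_t` over arms that the parameter-free algorithm with horizon `T` plays in
round `t ≥ 1` on the loss sequence `l`; it depends on `l 1, …, l (t - 1)` only. -/
def algDist (T : ℕ) (l : ℕ → Fin K → ℝ) (t : ℕ) : Fin K → ℝ :=
  roundDist t (lossAt l (t - 1)) (stateAfter T l (t - 1))

/-! ### Non-stationary stochastic environments -/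

variable {Ω : Type*} [MeasurableSpace Ω]

/-- The losses of the rounds `1, …, T` are independent random vectors with values in `[0, 1]^K`.
The coordinates of one vector may depend on each other. -/
structure IsEnvironment (P : MeasureTheory.Measure Ω) (T : ℕ) (l : ℕ → Ω → Fin K → ℝ) : Prop where
  measurable : ∀ t ∈ Finset.Icc 1 T, Measurable (l t)
  mem_Icc : ∀ t ∈ Finset.Icc 1 T, ∀ ω i, l t ω i ∈ Set.Icc (0 : ℝ) 1
  indep : ProbabilityTheory.iIndepFun (fun t : Finset.Icc 1 T => l (t : ℕ)) P

/-- The mean vector `μ_t`, with the convention `μ_0 = 0`. -/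
def mean (P : MeasureTheory.Measure Ω) (l : ℕ → Ω → Fin K → ℝ) : ℕ → Fin K → ℝ
  | 0 => 0
  | t + 1 => fun i => ∫ ω, l (t + 1) ω i ∂P

open Classical in
/-- `Γ = 1 + ∑_{t=2}^T 1_{μ_t ≠ μ_{t-1}}`. -/
def numSwitch (P : MeasureTheory.Measure Ω) (T : ℕ) (l : ℕ → Ω → Fin K → ℝ) : ℝ :=
  1 + ∑ t ∈ Finset.Icc 2 T, if mean P l t ≠ mean P l (t - 1) then 1 else 0

/-- The total drift `V = ∑_{t=1}^T ‖μ_t - μ_{t-1}‖_∞` (the norm of `Fin K → ℝ` is the sup norm). -/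
def totalDrift (P : MeasureTheory.Measure Ω) (T : ℕ) (l : ℕ → Ω → Fin K → ℝ) : ℝ :=
  ∑ t ∈ Finset.Icc 1 T, ‖mean P l t - mean P l (t - 1)‖

/-- The total variance `Λ = ∑_{t=1}^T E ‖ℓ_t - μ_t‖_2²`. -/
def totalVariance (P : MeasureTheory.Measure Ω) (T : ℕ) (l : ℕ → Ω → Fin K → ℝ) : ℝ :=
  ∑ t ∈ Finset.Icc 1 T, ∫ ω, ∑ i, (l t ω i - mean P l t i) ^ 2 ∂P

/-- The information contained in the losses of the rounds `1, …, t`. -/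
abbrev history (l : ℕ → Ω → Fin K → ℝ) (t : ℕ) : MeasurableSpace Ω :=
  ⨆ s ∈ Finset.Icc 1 t, MeasurableSpace.comap (l s) inferInstance

/-- `a t` is the arm chosen by the algorithm in round `t`: it is drawn from `p_t`, without
looking at the loss vector of round `t`, that is,
`P (a_t = k | ℓ_1, …, ℓ_t) = p_{t,k}`. -/
structure IsPlayOf (P : MeasureTheory.Measure Ω) (T : ℕ) (l : ℕ → Ω → Fin K → ℝ)
    (a : ℕ → Ω → Fin K) : Prop where
  measurable : ∀ t ∈ Finset.Icc 1 T, Measurable (a t)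
  law : ∀ t ∈ Finset.Icc 1 T, ∀ k : Fin K,
    MeasureTheory.condExp (history l t) P (Set.indicator {ω | a t ω = k} (fun _ => (1 : ℝ)))
      =ᵐ[P] fun ω => algDist T (fun s => l s ω) t k

/-- The expected dynamic regret `∑_{t=1}^T (E ℓ_{t,a_t} - min_i μ_{t,i})`. -/
def dynamicRegret (P : MeasureTheory.Measure Ω) (T : ℕ) (l : ℕ → Ω → Fin K → ℝ)
    (a : ℕ → Ω → Fin K) : ℝ :=
  ∑ t ∈ Finset.Icc 1 T, ((∫ ω, l t ω (a t ω) ∂P) - ⨅ i, mean P l t i)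

end NonstationaryExperts

end

/-!
The proof rests on a regret bound for a single interval of rounds and a fixed arm `k`, valid for
every loss sequence: for `0 < λ ≤ 1`,
`∑ (⟨p_t, ℓ_t⟩ - ℓ_{t,k}) ≤ C (1 + ln T) (λ ∑ ‖ℓ_t - ℓ_{t-1}‖_∞² + ln K / λ)`
(`interval_regret_le`). It is linear in the squared changes, so that it can be integrated and summed
over intervals before `λ` is optimized, without any use of Jensen's inequality.

The interval bound comes from the potential of Optimistic-Adapt-ML-Prod. Because
`exp (x - x²) ≤ 1 + x` and the instantaneous regrets average to zero, the total weight grows by at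
most `|E|` in each round (`sum_update_weight_le`), so that the logarithm of every weight stays
`O(ln |E|)`. On the other hand `ln w_{t,e} / η_{t,e}` grows by
`r_{t,e} - η_{t-1,e} (r_{t,e} - m_{t,e})²`, which bounds the regret to expert `e` by
`O(ln |E| + √(ln |E| (1 + ∑ (r_{t,e} - m_{t,e})²)))`. The expert `(s, k)` has `r = m = 0` while it is
asleep, and once it is awake the fixed-point equation turns `r - m` into the instantaneous regret for
the difference `ℓ_t - ℓ_{t-1}` (`instRegret_sub_estimate_round`). Hence it competes with arm `k` on
every interval that starts at `s`, and only the changes inside the interval count. Of the fixed point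
only the existence is needed.

In expectation, `‖ℓ_t - ℓ_{t-1}‖_∞²` is controlled by the variances of two rounds and the drift. The
intervals are the maximal pieces on which a comparator sequence is constant (`tracking_regret_le`).
For the bound in `Γ` the comparator is the best arm of each round; for the bound in `V` it is the best
arm at the start of each block of a suitable length, at the cost of a drift term. If the suitable
length exceeds `T`, the trivial bound `V T` suffices; it requires `p_t` to be independent of `ℓ_t`,
hence measurable in the past, and this rests on the measurability of the fixed point.
-/

noncomputable section

namespace NonstationaryExperts

/-! ### The potential of Optimistic-Adapt-ML-Prod -/

section Potential

variable {E : Type*} [Fintype E]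

/-- The states that can occur: positive weights, nonnegative error sums. -/
structure ProdState.Valid (σ : ProdState E) : Prop where
  weight_pos : ∀ k, 0 < σ.weight k
  err_nonneg : ∀ k, 0 ≤ σ.err k

lemma log_card_pos (hE : 2 ≤ Fintype.card E) : 0 < Real.log (Fintype.card E) :=
  Real.log_pos (by exact_mod_cast hE)

lemma half_le_log_card (hE : 2 ≤ Fintype.card E) : 1 / 2 ≤ Real.log (Fintype.card E) := by
  have h2 : Real.log 2 ≤ Real.log (Fintype.card E) :=
    Real.log_le_log (by norm_num) (by exact_mod_cast hE)
  linarith [Real.log_two_gt_d9]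

namespace ProdState

lemma valid_init (hE : 2 ≤ Fintype.card E) : (ProdState.init E).Valid where
  weight_pos _ := by
    have : (0 : ℝ) < Fintype.card E := by exact_mod_cast (by omega : 0 < Fintype.card E)
    simp only [ProdState.init]
    positivity
  err_nonneg _ := le_rfl

lemma rate_pos (hE : 2 ≤ Fintype.card E) {σ : ProdState E} {k : E} (hk : 0 ≤ σ.err k) :
    0 < σ.rate k := by
  have := log_card_pos hE
  unfold rate
  refine lt_min (by norm_num) (Real.sqrt_pos.2 ?_)
  positivity

lemma rate_le_quarter (σ : ProdState E) (k : E) : σ.rate k ≤ 1 / 4 := min_le_left _ _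

lemma inv_rate_le (σ : ProdState E) (k : E) :
    1 / σ.rate k ≤ 4 + Real.sqrt ((1 + σ.err k) / Real.log (Fintype.card E)) := by
  unfold rate
  rcases min_choice (1 / 4) (Real.sqrt (Real.log (Fintype.card E) / (1 + σ.err k))) with h | h
  · rw [h]
    linarith [Real.sqrt_nonneg ((1 + σ.err k) / Real.log (Fintype.card E))]
  · rw [h, one_div, ← Real.sqrt_inv, inv_div]
    linarith

lemma optWeight_pos {σ : ProdState E} (hσ : σ.Valid) (m : E → ℝ) (k : E) :
    0 < σ.optWeight m k :=
  mul_pos (hσ.weight_pos k) (Real.exp_pos _)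

lemma rate_mul_optWeight_pos (hE : 2 ≤ Fintype.card E) {σ : ProdState E} (hσ : σ.Valid)
    (m : E → ℝ) (k : E) : 0 < σ.rate k * σ.optWeight m k :=
  mul_pos (rate_pos hE (hσ.err_nonneg k)) (optWeight_pos hσ m k)

lemma sum_rate_mul_optWeight_pos (hE : 2 ≤ Fintype.card E) {σ : ProdState E} (hσ : σ.Valid)
    (m : E → ℝ) : 0 < ∑ j, σ.rate j * σ.optWeight m j := by
  have : Nonempty E := Fintype.card_pos_iff.1 (by omega)
  exact Finset.sum_pos (fun j _ => rate_mul_optWeight_pos hE hσ m j) Finset.univ_nonempty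

lemma play_pos (hE : 2 ≤ Fintype.card E) {σ : ProdState E} (hσ : σ.Valid)
    (m : E → ℝ) (k : E) : 0 < σ.play m k :=
  div_pos (rate_mul_optWeight_pos hE hσ m k) (sum_rate_mul_optWeight_pos hE hσ m)

lemma sum_play (hE : 2 ≤ Fintype.card E) {σ : ProdState E} (hσ : σ.Valid) (m : E → ℝ) :
    ∑ k, σ.play m k = 1 := by
  unfold play
  rw [← Finset.sum_div, div_self (sum_rate_mul_optWeight_pos hE hσ m).ne']

/-- The instantaneous regrets average to zero under the distribution played. -/
lemma sum_rate_mul_optWeight_mul_instRegret (hE : 2 ≤ Fintype.card E) {σ : ProdState E}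
    (hσ : σ.Valid) (m l : E → ℝ) :
    ∑ k, σ.rate k * σ.optWeight m k * σ.instRegret m l k = 0 := by
  have hZ := (sum_rate_mul_optWeight_pos hE hσ m).ne'
  have h : ∀ k, σ.rate k * σ.optWeight m k * σ.instRegret m l k
      = (∑ j, σ.rate j * σ.optWeight m j) * (σ.play m k * σ.instRegret m l k) := by
    intro k
    unfold play
    field_simp
  simp_rw [h, ← Finset.mul_sum]
  have h0 : ∑ k, σ.play m k * σ.instRegret m l k = 0 := by
    simp only [instRegret, mul_sub, Finset.sum_sub_distrib, ← Finset.sum_mul, sum_play hE hσ m]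
    ring
  rw [h0, mul_zero]

lemma newErr_nonneg {σ : ProdState E} (hσ : σ.Valid) (m l : E → ℝ) (k : E) :
    0 ≤ σ.newErr m l k :=
  add_nonneg (hσ.err_nonneg k) (sq_nonneg _)

lemma update_rate (σ : ProdState E) (m l : E → ℝ) (k : E) :
    (σ.update m l).rate k = σ.newRate m l k := rfl

lemma Valid.update {σ : ProdState E} (hσ : σ.Valid) (m l : E → ℝ) : (σ.update m l).Valid where
  weight_pos k := Real.rpow_pos_of_pos (mul_pos (hσ.weight_pos k) (Real.exp_pos _)) _
  err_nonneg := newErr_nonneg hσ m l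

lemma newRate_le_rate (hE : 2 ≤ Fintype.card E) {σ : ProdState E} (hσ : σ.Valid)
    (m l : E → ℝ) (k : E) : σ.newRate m l k ≤ σ.rate k := by
  have := log_card_pos hE
  have h0 := hσ.err_nonneg k
  unfold newRate rate
  refine min_le_min le_rfl (Real.sqrt_le_sqrt ?_)
  refine div_le_div_of_nonneg_left this.le (by linarith) ?_
  have : 0 ≤ (σ.instRegret m l k - m k) ^ 2 := sq_nonneg _
  simp only [newErr]
  linarith

end ProdState

lemma rpow_le_one_add {y β : ℝ} (hy : 0 < y) (hβ : 0 ≤ β) (hβ' : β ≤ 1) : y ^ β ≤ 1 + y := by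
  rcases le_total y 1 with h | h
  · linarith [Real.rpow_le_one hy.le h hβ]
  · have := Real.rpow_le_rpow_of_exponent_le h hβ'
    rw [Real.rpow_one] at this
    linarith

lemma exp_sub_sq_le {x : ℝ} (hx : |x| ≤ 1 / 2) : Real.exp (x - x ^ 2) ≤ 1 + x := by
  have hx' := abs_le.1 hx
  have h1 : (0 : ℝ) < 1 + x := by linarith
  rcases le_total 0 x with h | h
  · rw [← Real.le_log_iff_exp_le h1]
    refine le_trans ?_ (Real.le_log_one_add_of_nonneg h)
    rw [le_div_iff₀ (by linarith)]
    nlinarith [pow_nonneg h 3, sq_nonneg x]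
  · have hz : 0 ≤ x ^ 2 - x := by nlinarith
    have h2 := Real.quadratic_le_exp_of_nonneg hz
    have h3 : Real.exp (x - x ^ 2) = (Real.exp (x ^ 2 - x))⁻¹ := by
      rw [← Real.exp_neg]; ring_nf
    rw [h3, inv_le_iff_one_le_mul₀ (Real.exp_pos _)]
    refine le_trans ?_ (mul_le_mul_of_nonneg_left h2 h1.le)
    -- The difference of the two sides is `x² (1 + x - x² + x³) / 2`.
    have h4 : 0 ≤ 1 + x - x ^ 2 + x ^ 3 := by nlinarith
    nlinarith [mul_nonneg (sq_nonneg x) h4]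

namespace ProdState

/-- The prod potential: since `exp (x - x²) ≤ 1 + x` and `(1 - x) exp x ≤ 1`, the total weight before
the learning rates are adjusted does not increase. -/
lemma sum_weight_mul_exp_le (hE : 2 ≤ Fintype.card E) {σ : ProdState E} (hσ : σ.Valid)
    (m l : E → ℝ) (hx : ∀ k, |σ.instRegret m l k - m k| ≤ 2) :
    ∑ k, σ.weight k * Real.exp (σ.rate k * σ.instRegret m l k
        - σ.rate k ^ 2 * (σ.instRegret m l k - m k) ^ 2) ≤ ∑ k, σ.weight k := by
  have key : ∀ k, σ.weight k * Real.exp (σ.rate k * σ.instRegret m l k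
        - σ.rate k ^ 2 * (σ.instRegret m l k - m k) ^ 2)
      ≤ σ.weight k + σ.rate k * σ.optWeight m k * σ.instRegret m l k := by
    intro k
    have hη := rate_pos hE (hσ.err_nonneg k)
    have hη' := σ.rate_le_quarter k
    have hw := hσ.weight_pos k
    set η := σ.rate k
    set r := σ.instRegret m l k
    have h1 : |η * (r - m k)| ≤ 1 / 2 := by
      rw [abs_mul, abs_of_pos hη]
      nlinarith [hx k, abs_nonneg (r - m k)]
    have h2 := exp_sub_sq_le h1
    have h3 : Real.exp (η * r - η ^ 2 * (r - m k) ^ 2)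
        = Real.exp (η * m k) * Real.exp (η * (r - m k) - (η * (r - m k)) ^ 2) := by
      rw [← Real.exp_add]; ring_nf
    have h4 : Real.exp (η * m k) * (1 - η * m k) ≤ 1 := by
      have h5 := Real.add_one_le_exp (-(η * m k))
      calc Real.exp (η * m k) * (1 - η * m k)
          ≤ Real.exp (η * m k) * Real.exp (-(η * m k)) := by gcongr; linarith
        _ = 1 := by rw [← Real.exp_add]; simp
    have h6 : Real.exp (η * r - η ^ 2 * (r - m k) ^ 2)
        ≤ 1 + η * Real.exp (η * m k) * r := by
      rw [h3]
      calc _ ≤ Real.exp (η * m k) * (1 + η * (r - m k)) := by gcongr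
        _ = Real.exp (η * m k) * (1 - η * m k) + η * Real.exp (η * m k) * r := by ring
        _ ≤ _ := by linarith
    calc _ ≤ σ.weight k * (1 + η * Real.exp (η * m k) * r) := by gcongr
      _ = _ := by unfold optWeight; ring
  calc _ ≤ ∑ k, (σ.weight k + σ.rate k * σ.optWeight m k * σ.instRegret m l k) :=
        Finset.sum_le_sum fun k _ => key k
    _ = _ := by
      rw [Finset.sum_add_distrib, sum_rate_mul_optWeight_mul_instRegret hE hσ, add_zero]

lemma sum_update_weight_le (hE : 2 ≤ Fintype.card E) {σ : ProdState E} (hσ : σ.Valid)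
    (m l : E → ℝ) (hx : ∀ k, |σ.instRegret m l k - m k| ≤ 2) :
    ∑ k, (σ.update m l).weight k ≤ Fintype.card E + ∑ k, σ.weight k := by
  refine le_trans ?_ (add_le_add_right (sum_weight_mul_exp_le hE hσ m l hx) _)
  have : (Fintype.card E : ℝ) = ∑ _k : E, (1 : ℝ) := by simp
  rw [this, ← Finset.sum_add_distrib]
  refine Finset.sum_le_sum fun k _ => ?_
  have hη := rate_pos hE (hσ.err_nonneg k)
  have hη' : 0 < σ.newRate m l k := rate_pos hE (newErr_nonneg hσ m l k)
  exact rpow_le_one_add (mul_pos (hσ.weight_pos k) (Real.exp_pos _)) (by positivity)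
    ((div_le_one hη).2 (newRate_le_rate hE hσ m l k))

/-- The quantity whose increments dominate the instantaneous regret to expert `k`. Its first part
telescopes because of the exponent `η_t / η_{t-1}` in the update, its second part pays for the
second-order terms `η_{t-1} (r_t - m_t)²`. -/
def potential (σ : ProdState E) (k : E) : ℝ :=
  Real.log (σ.weight k) / σ.rate k
    + 5 * (Real.sqrt (Real.log (Fintype.card E)) * Real.sqrt (1 + σ.err k))

lemma instRegret_add_potential_le (hE : 2 ≤ Fintype.card E) {σ : ProdState E} (hσ : σ.Valid)
    (m l : E → ℝ) (k : E) (hx : |σ.instRegret m l k - m k| ≤ 2) :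
    σ.instRegret m l k + σ.potential k ≤ (σ.update m l).potential k := by
  have hη := rate_pos hE (hσ.err_nonneg k)
  have hη' : 0 < σ.newRate m l k := rate_pos hE (newErr_nonneg hσ m l k)
  have hw := hσ.weight_pos k
  have h1 : Real.log ((σ.update m l).weight k) / (σ.update m l).rate k
      = Real.log (σ.weight k) / σ.rate k + σ.instRegret m l k
        - σ.rate k * (σ.instRegret m l k - m k) ^ 2 := by
    rw [update_rate]
    simp only [update]
    rw [Real.log_rpow (mul_pos hw (Real.exp_pos _)), Real.log_mul hw.ne' (Real.exp_pos _).ne',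
      Real.log_exp]
    field_simp
    ring
  have h2 : σ.rate k * (σ.instRegret m l k - m k) ^ 2
      ≤ 5 * (Real.sqrt (Real.log (Fintype.card E)) * (Real.sqrt (1 + σ.newErr m l k)
        - Real.sqrt (1 + σ.err k))) := by
    have hx2 : (σ.instRegret m l k - m k) ^ 2 ≤ 4 := by
      have := abs_le.1 hx
      nlinarith
    have hx0 : 0 ≤ (σ.instRegret m l k - m k) ^ 2 := sq_nonneg _
    simp only [newErr]
    set y := (σ.instRegret m l k - m k) ^ 2
    have ha : 0 ≤ σ.err k := hσ.err_nonneg k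
    have hle : σ.rate k ≤ Real.sqrt (Real.log (Fintype.card E)) / Real.sqrt (1 + σ.err k) := by
      rw [← Real.sqrt_div (log_card_pos hE).le]
      exact min_le_right _ _
    set c := Real.sqrt (Real.log (Fintype.card E))
    have hc : 0 ≤ c := Real.sqrt_nonneg _
    set p := Real.sqrt (1 + σ.err k) with hp
    have hp1 : 1 ≤ p := Real.one_le_sqrt.2 (by linarith)
    set q := Real.sqrt (1 + (σ.err k + y)) with hq
    have hp2 : p ^ 2 = 1 + σ.err k := Real.sq_sqrt (by linarith)
    have hq2 : q ^ 2 = 1 + (σ.err k + y) := Real.sq_sqrt (by linarith)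
    have hq0 : 0 ≤ q := Real.sqrt_nonneg _
    -- `q² = p² + y ≤ 5 p²`, so that `y = (q - p) (q + p) ≤ 5 p (q - p)`.
    have hq4 : q ≤ 4 * p := by nlinarith
    have hpq : p ≤ q := Real.sqrt_le_sqrt (by linarith)
    have hy : y ≤ 5 * p * (q - p) := by nlinarith
    calc σ.rate k * y ≤ c / p * (5 * p * (q - p)) := by gcongr
      _ = 5 * (c * (q - p)) := by field_simp
  unfold potential
  rw [h1]
  have h3 : (σ.update m l).err k = σ.newErr m l k := rfl
  rw [h3]
  linarith

lemma potential_init_ge (hE : 2 ≤ Fintype.card E) (k : E) :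
    -(4 * Real.log (Fintype.card E)) ≤ (ProdState.init E).potential k := by
  have hN := half_le_log_card hE
  have hrate : (ProdState.init E).rate k = 1 / 4 := by
    unfold rate
    refine min_eq_left (Real.le_sqrt_of_sq_le ?_)
    simp only [ProdState.init]
    rw [add_zero, div_one]
    linarith
  unfold potential
  rw [hrate]
  simp only [ProdState.init]
  rw [one_div, Real.log_inv]
  have : 0 ≤ Real.sqrt (Real.log (Fintype.card E)) * Real.sqrt (1 + 0) := by positivity
  rw [div_div_eq_mul_div, div_one]
  linarith

lemma potential_le (hE : 2 ≤ Fintype.card E) {σ : ProdState E} (hσ : σ.Valid) (k : E)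
    {B : ℝ} (hB : 0 ≤ B) (hw : Real.log (σ.weight k) ≤ B * Real.log (Fintype.card E)) :
    σ.potential k ≤ 4 * B * Real.log (Fintype.card E)
      + (B + 5) * (Real.sqrt (Real.log (Fintype.card E)) * Real.sqrt (1 + σ.err k)) := by
  have hN := log_card_pos hE
  have hη := rate_pos hE (hσ.err_nonneg k)
  have he := hσ.err_nonneg k
  have h1 : Real.log (σ.weight k) / σ.rate k ≤ B * Real.log (Fintype.card E)
      * (4 + Real.sqrt ((1 + σ.err k) / Real.log (Fintype.card E))) := by
    rw [div_eq_mul_one_div]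
    calc _ ≤ B * Real.log (Fintype.card E) * (1 / σ.rate k) := by gcongr
      _ ≤ _ := by gcongr; exact inv_rate_le σ k
  have h2 : Real.log (Fintype.card E) * Real.sqrt ((1 + σ.err k) / Real.log (Fintype.card E))
      = Real.sqrt (Real.log (Fintype.card E)) * Real.sqrt (1 + σ.err k) := by
    rw [Real.sqrt_div (by linarith)]
    set c := Real.sqrt (Real.log (Fintype.card E)) with hc
    have hc0 : c ≠ 0 := (Real.sqrt_pos.2 hN).ne'
    have hc2 : Real.log (Fintype.card E) = c * c := (Real.mul_self_sqrt hN.le).symm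
    rw [hc2]
    field_simp
  unfold potential
  nlinarith [h1, h2]

end ProdState

end Potential

/-! ### Sleeping experts and the fixed point -/

section Sleeping

variable {T K : ℕ}

lemma two_le_card_experts (hKT : 2 ≤ K * T) : 2 ≤ Fintype.card (Fin T × Fin K) := by
  simpa [mul_comm] using hKT

lemma awakeMass_pos (hT : 0 < T) {t : ℕ} (ht : 1 ≤ t) {q : Fin T × Fin K → ℝ}
    (hq : ∀ e, 0 < q e) (k : Fin K) :
    0 < ∑ s : Fin T, if Awake t (s, k) then q (s, k) else 0 := by
  refine Finset.sum_pos' (fun s _ => ?_) ⟨⟨0, hT⟩, Finset.mem_univ _, ?_⟩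
  · split_ifs
    exacts [(hq _).le, le_rfl]
  · rw [if_pos (show Awake t ((⟨0, hT⟩ : Fin T), k) by simpa [Awake] using ht)]
    exact hq _

lemma totalAwakeMass_pos (hT : 0 < T) (hK : 0 < K) {t : ℕ} (ht : 1 ≤ t) {q : Fin T × Fin K → ℝ}
    (hq : ∀ e, 0 < q e) :
    0 < ∑ k : Fin K, ∑ s : Fin T, if Awake t (s, k) then q (s, k) else 0 :=
  Finset.sum_pos (fun k _ => awakeMass_pos hT ht hq k) ⟨⟨0, hK⟩, Finset.mem_univ _⟩

lemma armDist_nonneg {t : ℕ} {q : Fin T × Fin K → ℝ} (hq : ∀ e, 0 < q e) (k : Fin K) :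
    0 ≤ armDist t q k := by
  have h : ∀ k, 0 ≤ ∑ s : Fin T, if Awake t (s, k) then q (s, k) else 0 := fun k =>
    Finset.sum_nonneg fun s _ => by
      split_ifs
      exacts [(hq _).le, le_rfl]
  exact div_nonneg (h k) (Finset.sum_nonneg fun k' _ => h k')

lemma sum_armDist (hT : 0 < T) (hK : 0 < K) {t : ℕ} (ht : 1 ≤ t) {q : Fin T × Fin K → ℝ}
    (hq : ∀ e, 0 < q e) : ∑ k, armDist t q k = 1 := by
  unfold armDist
  rw [← Finset.sum_div, div_self (totalAwakeMass_pos hT hK ht hq).ne']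

/-- Feeding the expected loss to the sleeping experts makes the expected loss over the experts
equal to the expected loss over the arms. -/
lemma sum_mul_sleepingLoss (hT : 0 < T) (hK : 0 < K) {t : ℕ} (ht : 1 ≤ t)
    {q : Fin T × Fin K → ℝ} (hq : ∀ e, 0 < q e) (hq1 : ∑ e, q e = 1) (c : Fin K → ℝ) :
    ∑ e, q e * (if Awake t e then c e.2 else ∑ k, armDist t q k * c k)
      = ∑ k, armDist t q k * c k := by
  set L := ∑ k, armDist t q k * c k with hL
  set Z := ∑ k : Fin K, ∑ s : Fin T, if Awake t (s, k) then q (s, k) else 0 with hZ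
  have hZ0 : Z ≠ 0 := (totalAwakeMass_pos hT hK ht hq).ne'
  have h1 : Z * L = ∑ e, if Awake t e then q e * c e.2 else 0 := by
    rw [hL, Finset.mul_sum, Fintype.sum_prod_type_right]
    refine Finset.sum_congr rfl fun k _ => ?_
    unfold armDist
    rw [← hZ, ← mul_assoc, mul_div_cancel₀ _ hZ0, Finset.sum_mul]
    refine Finset.sum_congr rfl fun s _ => ?_
    split_ifs <;> simp
  have h2 : Z = ∑ e, if Awake t e then q e else 0 := by
    rw [hZ, Fintype.sum_prod_type_right]
  have h3 : ∀ e, q e * (if Awake t e then c e.2 else L)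
      = (if Awake t e then q e * c e.2 else 0) + (q e * L - (if Awake t e then q e else 0) * L) := by
    intro e
    split_ifs <;> ring
  simp_rw [h3]
  rw [Finset.sum_add_distrib, Finset.sum_sub_distrib, ← Finset.sum_mul, ← Finset.sum_mul, ← h1,
    ← h2, hq1]
  ring

lemma continuous_play_estimate (hKT : 2 ≤ K * T) (t : ℕ) (prev : Fin K → ℝ)
    {σ : ProdState (Fin T × Fin K)} (hσ : σ.Valid) (e : Fin T × Fin K) :
    Continuous fun α => σ.play (estimate t prev α) e := by
  have hm : ∀ e : Fin T × Fin K, Continuous fun α => estimate t prev α e := by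
    intro e
    unfold estimate
    split_ifs <;> fun_prop
  have hw : ∀ e, Continuous fun α => σ.optWeight (estimate t prev α) e := by
    intro e
    have := hm e
    unfold ProdState.optWeight
    fun_prop
  unfold ProdState.play
  refine Continuous.div (by fun_prop) (by fun_prop) fun α => ?_
  exact (ProdState.sum_rate_mul_optWeight_pos (two_le_card_experts hKT) hσ _).ne'

lemma continuous_predictedLoss (hKT : 2 ≤ K * T) {t : ℕ} (ht : 1 ≤ t) (prev : Fin K → ℝ)
    {σ : ProdState (Fin T × Fin K)} (hσ : σ.Valid) :
    Continuous fun α => predictedLoss t prev σ α := by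
  have hK : 0 < K := Nat.pos_of_mul_pos_right (by omega : 0 < K * T)
  have hT : 0 < T := Nat.pos_of_mul_pos_left (by omega : 0 < K * T)
  have hp := continuous_play_estimate hKT t prev hσ
  have hs : ∀ k : Fin K, Continuous fun α => ∑ s : Fin T,
      if Awake t (s, k) then σ.play (estimate t prev α) (s, k) else 0 := by
    intro k
    refine continuous_finsetSum _ fun s _ => ?_
    split_ifs
    exacts [hp _, continuous_const]
  unfold predictedLoss armDist
  refine continuous_finsetSum _ fun k _ => Continuous.mul (Continuous.div (hs k)
    (continuous_finsetSum _ fun k _ => hs k) fun α => ?_) continuous_const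
  exact (totalAwakeMass_pos hT hK ht
    (ProdState.play_pos (two_le_card_experts hKT) hσ _)).ne'

/-- An average of numbers in `[0, 1]` is in `[0, 1]`. -/
lemma sum_mul_mem_Icc {p c : Fin K → ℝ} (hp : ∀ k, 0 ≤ p k) (hp1 : ∑ k, p k = 1)
    (hc : ∀ k, c k ∈ Set.Icc (0 : ℝ) 1) : ∑ k, p k * c k ∈ Set.Icc (0 : ℝ) 1 := by
  refine ⟨Finset.sum_nonneg fun k _ => mul_nonneg (hp k) (hc k).1, ?_⟩
  rw [← hp1]
  exact Finset.sum_le_sum fun k _ => mul_le_of_le_one_right (hp k) (hc k).2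

lemma predictedLoss_mem_Icc (hKT : 2 ≤ K * T) {t : ℕ} (ht : 1 ≤ t) {prev : Fin K → ℝ}
    (hprev : ∀ k, prev k ∈ Set.Icc (0 : ℝ) 1) {σ : ProdState (Fin T × Fin K)} (hσ : σ.Valid)
    (α : ℝ) : predictedLoss t prev σ α ∈ Set.Icc (0 : ℝ) 1 := by
  have hK : 0 < K := Nat.pos_of_mul_pos_right (by omega : 0 < K * T)
  have hT : 0 < T := Nat.pos_of_mul_pos_left (by omega : 0 < K * T)
  have hq := ProdState.play_pos (two_le_card_experts hKT) hσ (estimate t prev α)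
  exact sum_mul_mem_Icc (armDist_nonneg hq) (sum_armDist hT hK ht hq) hprev

/-- The infimum naming the fixed point is attained: the set of fixed points is nonempty by the
intermediate value theorem and closed by continuity. -/
lemma fixedPoint_mem (hKT : 2 ≤ K * T) {t : ℕ} (ht : 1 ≤ t) {prev : Fin K → ℝ}
    (hprev : ∀ k, prev k ∈ Set.Icc (0 : ℝ) 1) {σ : ProdState (Fin T × Fin K)} (hσ : σ.Valid) :
    fixedPoint t prev σ ∈
      {α : ℝ | α ∈ Set.Icc (0 : ℝ) 1 ∧ predictedLoss t prev σ α = α} := by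
  have hc := continuous_predictedLoss hKT ht prev hσ
  have hm := predictedLoss_mem_Icc hKT ht hprev hσ
  refine IsClosed.csInf_mem ?_ ?_ ⟨0, fun α hα => hα.1.1⟩
  · exact isClosed_Icc.inter (isClosed_eq hc continuous_id)
  · have h := intermediate_value_Icc' (f := fun α => predictedLoss t prev σ α - α)
      zero_le_one (by fun_prop : Continuous _).continuousOn
    obtain ⟨α, hα, h0⟩ := h (show (0 : ℝ) ∈ Set.Icc _ _ from
      ⟨by linarith [(hm 1).2], by linarith [(hm 0).1]⟩)
    exact ⟨α, hα, sub_eq_zero.1 h0⟩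

lemma roundDist_nonneg (hKT : 2 ≤ K * T) (t : ℕ) (prev : Fin K → ℝ)
    {σ : ProdState (Fin T × Fin K)} (hσ : σ.Valid) (k : Fin K) : 0 ≤ roundDist t prev σ k :=
  armDist_nonneg (ProdState.play_pos (two_le_card_experts hKT) hσ _) k

lemma sum_roundDist (hKT : 2 ≤ K * T) {t : ℕ} (ht : 1 ≤ t) (prev : Fin K → ℝ)
    {σ : ProdState (Fin T × Fin K)} (hσ : σ.Valid) : ∑ k, roundDist t prev σ k = 1 :=
  sum_armDist (Nat.pos_of_mul_pos_left (by omega : 0 < K * T))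
    (Nat.pos_of_mul_pos_right (by omega : 0 < K * T)) ht
    (ProdState.play_pos (two_le_card_experts hKT) hσ _)

lemma instRegret_round (hKT : 2 ≤ K * T) {t : ℕ} (ht : 1 ≤ t) (prev cur : Fin K → ℝ)
    {σ : ProdState (Fin T × Fin K)} (hσ : σ.Valid) (e : Fin T × Fin K) :
    σ.instRegret (roundEstimate t prev σ) (roundLoss t prev cur σ) e
      = if Awake t e then (∑ k, roundDist t prev σ k * cur k) - cur e.2 else 0 := by
  have hE := two_le_card_experts hKT
  have h := sum_mul_sleepingLoss (Nat.pos_of_mul_pos_left (by omega : 0 < K * T))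
    (Nat.pos_of_mul_pos_right (by omega : 0 < K * T)) ht
    (ProdState.play_pos hE hσ (roundEstimate t prev σ)) (ProdState.sum_play hE hσ _) cur
  unfold ProdState.instRegret roundLoss
  unfold roundDist
  rw [h]
  split_ifs
  · rfl
  · exact sub_self _

/-- For an awake expert the estimation error is the instantaneous regret for the loss difference
`ℓ_t - ℓ_{t-1}`; this is where the fixed-point equation is used. -/
lemma instRegret_sub_estimate_round (hKT : 2 ≤ K * T) {t : ℕ} (ht : 1 ≤ t) {prev : Fin K → ℝ}
    (hprev : ∀ k, prev k ∈ Set.Icc (0 : ℝ) 1) (cur : Fin K → ℝ)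
    {σ : ProdState (Fin T × Fin K)} (hσ : σ.Valid) (e : Fin T × Fin K) :
    σ.instRegret (roundEstimate t prev σ) (roundLoss t prev cur σ) e - roundEstimate t prev σ e
      = if Awake t e then
          (∑ k, roundDist t prev σ k * (cur k - prev k)) - (cur e.2 - prev e.2) else 0 := by
  have hα : ∑ k, roundDist t prev σ k * prev k = fixedPoint t prev σ :=
    (fixedPoint_mem hKT ht hprev hσ).2
  rw [instRegret_round hKT ht prev cur hσ]
  unfold roundEstimate estimate
  split_ifs
  · simp only [mul_sub, Finset.sum_sub_distrib, hα]
    ring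
  · exact sub_self _

lemma abs_instRegret_sub_estimate_round_le (hKT : 2 ≤ K * T) {t : ℕ} (ht : 1 ≤ t)
    {prev : Fin K → ℝ} (hprev : ∀ k, prev k ∈ Set.Icc (0 : ℝ) 1) (cur : Fin K → ℝ)
    {σ : ProdState (Fin T × Fin K)} (hσ : σ.Valid) (e : Fin T × Fin K) :
    |σ.instRegret (roundEstimate t prev σ) (roundLoss t prev cur σ) e - roundEstimate t prev σ e|
      ≤ if Awake t e then 2 * ‖cur - prev‖ else 0 := by
  rw [instRegret_sub_estimate_round hKT ht hprev cur hσ]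
  split_ifs
  · have hn : ∀ k, |cur k - prev k| ≤ ‖cur - prev‖ := fun k => norm_le_pi_norm (cur - prev) k
    have h1 : |∑ k, roundDist t prev σ k * (cur k - prev k)| ≤ ‖cur - prev‖ :=
      calc _ ≤ ∑ k, |roundDist t prev σ k * (cur k - prev k)| := Finset.abs_sum_le_sum_abs _ _
        _ ≤ ∑ k, roundDist t prev σ k * ‖cur - prev‖ := by
          refine Finset.sum_le_sum fun k _ => ?_
          have hp := roundDist_nonneg hKT t prev hσ k
          rw [abs_mul, abs_of_nonneg hp]
          exact mul_le_mul_of_nonneg_left (hn k) hp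
        _ = _ := by rw [← Finset.sum_mul, sum_roundDist hKT ht prev hσ, one_mul]
    refine (abs_sub _ _).trans ?_
    linarith [hn e.2]
  · simp

lemma norm_sub_le_one {prev cur : Fin K → ℝ} (hprev : ∀ k, prev k ∈ Set.Icc (0 : ℝ) 1)
    (hcur : ∀ k, cur k ∈ Set.Icc (0 : ℝ) 1) : ‖cur - prev‖ ≤ 1 := by
  refine (pi_norm_le_iff_of_nonneg zero_le_one).2 fun k => ?_
  rw [Pi.sub_apply, Real.norm_eq_abs, abs_le]
  exact ⟨by linarith [(hprev k).2, (hcur k).1], by linarith [(hprev k).1, (hcur k).2]⟩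

/-! ### Regret on an interval -/

lemma valid_stateAfter (hKT : 2 ≤ K * T) (l : ℕ → Fin K → ℝ) (t : ℕ) :
    (stateAfter T l t).Valid := by
  induction t with
  | zero => exact ProdState.valid_init (two_le_card_experts hKT)
  | succ t ih => exact ih.update _ _

lemma algDist_succ (T : ℕ) (l : ℕ → Fin K → ℝ) (t : ℕ) :
    algDist T l (t + 1) = roundDist (t + 1) (lossAt l t) (stateAfter T l t) := rfl

lemma algDist_nonneg (hKT : 2 ≤ K * T) (l : ℕ → Fin K → ℝ) (t : ℕ) (k : Fin K) :
    0 ≤ algDist T l t k :=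
  roundDist_nonneg hKT _ _ (valid_stateAfter hKT l _) k

lemma sum_algDist (hKT : 2 ≤ K * T) (l : ℕ → Fin K → ℝ) {t : ℕ} (ht : 1 ≤ t) :
    ∑ k, algDist T l t k = 1 :=
  sum_roundDist hKT ht _ (valid_stateAfter hKT l _)

lemma algDist_le_one (hKT : 2 ≤ K * T) (l : ℕ → Fin K → ℝ) {t : ℕ} (ht : 1 ≤ t) (k : Fin K) :
    algDist T l t k ≤ 1 := by
  rw [← sum_algDist hKT l ht]
  exact Finset.single_le_sum (fun i _ => algDist_nonneg hKT l t i) (Finset.mem_univ k)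

lemma lossAt_mem_Icc {l : ℕ → Fin K → ℝ}
    (hl : ∀ t ∈ Finset.Icc 1 T, ∀ k, l t k ∈ Set.Icc (0 : ℝ) 1) {t : ℕ} (ht : t ≤ T) (k : Fin K) :
    lossAt l t k ∈ Set.Icc (0 : ℝ) 1 := by
  cases t with
  | zero => exact ⟨le_rfl, zero_le_one⟩
  | succ t => exact hl (t + 1) (Finset.mem_Icc.2 ⟨by omega, ht⟩) k

lemma lossAt_of_pos (l : ℕ → Fin K → ℝ) {t : ℕ} (ht : 1 ≤ t) : lossAt l t = l t := by
  obtain ⟨t, rfl⟩ := Nat.exists_eq_add_of_le' ht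
  rfl

section Run

variable {l : ℕ → Fin K → ℝ}

lemma sum_weight_stateAfter_le (hKT : 2 ≤ K * T)
    (hl : ∀ t ∈ Finset.Icc 1 T, ∀ k, l t k ∈ Set.Icc (0 : ℝ) 1) {n : ℕ} (hn : n ≤ T) :
    ∑ e, (stateAfter T l n).weight e ≤ 1 + n * (Fintype.card (Fin T × Fin K) : ℝ) := by
  have hE := two_le_card_experts hKT
  induction n with
  | zero =>
    have : (Fintype.card (Fin T × Fin K) : ℝ) ≠ 0 := by
      exact_mod_cast (by omega : Fintype.card (Fin T × Fin K) ≠ 0)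
    simp only [stateAfter, ProdState.init, Finset.sum_const, Finset.card_univ, nsmul_eq_mul]
    rw [mul_one_div_cancel this]
    simp
  | succ n ih =>
    have hprev := fun k => lossAt_mem_Icc hl (by omega : n ≤ T) k
    have h := ProdState.sum_update_weight_le hE (valid_stateAfter hKT l n)
      (roundEstimate (n + 1) (lossAt l n) (stateAfter T l n))
      (roundLoss (n + 1) (lossAt l n) (l (n + 1)) (stateAfter T l n)) fun e => by
        refine (abs_instRegret_sub_estimate_round_le hKT (by omega) hprev _
          (valid_stateAfter hKT l n) e).trans ?_
        have := norm_sub_le_one hprev (hl (n + 1) (Finset.mem_Icc.2 ⟨by omega, hn⟩))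
        split_ifs <;> linarith
    have ih := ih (by omega)
    push_cast
    simp only [stateAfter]
    linarith

/-- The error sums of expert `(s, k)` collect only the rounds from `s + 1` on. -/
lemma err_stateAfter_le (hKT : 2 ≤ K * T)
    (hl : ∀ t ∈ Finset.Icc 1 T, ∀ k, l t k ∈ Set.Icc (0 : ℝ) 1) {n : ℕ} (hn : n ≤ T)
    (e : Fin T × Fin K) :
    (stateAfter T l n).err e
      ≤ ∑ t ∈ Finset.Icc ((e.1 : ℕ) + 1) n, 4 * ‖lossAt l t - lossAt l (t - 1)‖ ^ 2 := by
  induction n with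
  | zero => simp [stateAfter, ProdState.init]
  | succ n ih =>
    have hprev := fun k => lossAt_mem_Icc hl (by omega : n ≤ T) k
    have h := abs_instRegret_sub_estimate_round_le hKT (by omega : 1 ≤ n + 1) hprev (l (n + 1))
      (valid_stateAfter hKT l n) e
    have ih := ih (by omega)
    have hnew : (stateAfter T l (n + 1)).err e = (stateAfter T l n).err e
        + ((stateAfter T l n).instRegret (roundEstimate (n + 1) (lossAt l n) (stateAfter T l n))
            (roundLoss (n + 1) (lossAt l n) (l (n + 1)) (stateAfter T l n)) e
          - roundEstimate (n + 1) (lossAt l n) (stateAfter T l n) e) ^ 2 := rfl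
    rw [hnew]
    by_cases ha : Awake (n + 1) e
    · rw [if_pos ha] at h
      rw [Finset.sum_Icc_succ_top (show (e.1 : ℕ) + 1 ≤ n + 1 from ha)]
      have h2 := sq_le_sq' (by linarith [(abs_le.1 h).1]) (abs_le.1 h).2
      have h3 : lossAt l (n + 1) - lossAt l (n + 1 - 1) = l (n + 1) - lossAt l n := rfl
      rw [h3]
      linarith
    · rw [if_neg ha] at h
      have h0 := abs_eq_zero.1 (le_antisymm h (abs_nonneg _))
      have he : Finset.Icc ((e.1 : ℕ) + 1) (n + 1) = ∅ := Finset.Icc_eq_empty ha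
      have he' : Finset.Icc ((e.1 : ℕ) + 1) n = ∅ :=
        Finset.Icc_eq_empty fun h => ha (show (e.1 : ℕ) + 1 ≤ n + 1 by omega)
      rw [he'] at ih
      rw [h0, he]
      simpa using ih

lemma sum_regret_add_potential_le (hKT : 2 ≤ K * T)
    (hl : ∀ t ∈ Finset.Icc 1 T, ∀ k, l t k ∈ Set.Icc (0 : ℝ) 1) {n : ℕ} (hn : n ≤ T)
    (e : Fin T × Fin K) :
    ∑ t ∈ Finset.Icc ((e.1 : ℕ) + 1) n, ((∑ k, algDist T l t k * l t k) - l t e.2)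
      + (ProdState.init (Fin T × Fin K)).potential e ≤ (stateAfter T l n).potential e := by
  induction n with
  | zero => simp [stateAfter]
  | succ n ih =>
    have hprev := fun k => lossAt_mem_Icc hl (by omega : n ≤ T) k
    have ih := ih (by omega)
    have hσ := valid_stateAfter hKT l n
    have h := ProdState.instRegret_add_potential_le (two_le_card_experts hKT) hσ
      (roundEstimate (n + 1) (lossAt l n) (stateAfter T l n))
      (roundLoss (n + 1) (lossAt l n) (l (n + 1)) (stateAfter T l n)) e (by
        refine (abs_instRegret_sub_estimate_round_le hKT (by omega) hprev _ hσ e).trans ?_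
        have := norm_sub_le_one hprev (hl (n + 1) (Finset.mem_Icc.2 ⟨by omega, hn⟩))
        split_ifs <;> linarith)
    rw [instRegret_round hKT (by omega) _ _ hσ] at h
    have hs : stateAfter T l (n + 1) = (stateAfter T l n).update
      (roundEstimate (n + 1) (lossAt l n) (stateAfter T l n))
      (roundLoss (n + 1) (lossAt l n) (l (n + 1)) (stateAfter T l n)) := rfl
    rw [hs]
    by_cases ha : Awake (n + 1) e
    · rw [if_pos ha] at h
      rw [Finset.sum_Icc_succ_top (show (e.1 : ℕ) + 1 ≤ n + 1 from ha)]
      simp only [algDist_succ] at ih ⊢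
      linarith
    · rw [if_neg ha] at h
      have he : Finset.Icc ((e.1 : ℕ) + 1) (n + 1) = ∅ := Finset.Icc_eq_empty ha
      have he' : Finset.Icc ((e.1 : ℕ) + 1) n = ∅ :=
        Finset.Icc_eq_empty fun h => ha (show (e.1 : ℕ) + 1 ≤ n + 1 by omega)
      rw [he'] at ih
      rw [he]
      linarith

lemma log_weight_stateAfter_le (hKT : 2 ≤ K * T)
    (hl : ∀ t ∈ Finset.Icc 1 T, ∀ k, l t k ∈ Set.Icc (0 : ℝ) 1) {n : ℕ} (hn : n ≤ T)
    (e : Fin T × Fin K) :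
    Real.log ((stateAfter T l n).weight e)
      ≤ 3 * Real.log (Fintype.card (Fin T × Fin K)) := by
  have hE := two_le_card_experts hKT
  have hσ := valid_stateAfter hKT l n
  set N := Fintype.card (Fin T × Fin K) with hN
  have hTN : T ≤ N := by
    have hK : 0 < K := Nat.pos_of_mul_pos_right (by omega : 0 < K * T)
    rw [hN, Fintype.card_prod, Fintype.card_fin, Fintype.card_fin]
    exact Nat.le_mul_of_pos_right T hK
  have h1 : (stateAfter T l n).weight e ≤ 1 + n * (N : ℝ) :=
    (Finset.single_le_sum (fun i _ => (hσ.weight_pos i).le) (Finset.mem_univ e)).trans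
      (sum_weight_stateAfter_le hKT hl hn)
  have h2 : 1 + n * (N : ℝ) ≤ (N : ℝ) ^ 3 := by
    have h3 : (2 : ℝ) ≤ N := by exact_mod_cast hE
    have h4 : (n : ℝ) ≤ N := by exact_mod_cast hn.trans hTN
    nlinarith [mul_le_mul_of_nonneg_right h4 (by linarith : (0 : ℝ) ≤ N),
      mul_nonneg (sub_nonneg.2 h3) (sq_nonneg (N : ℝ))]
  calc _ ≤ Real.log ((N : ℝ) ^ 3) := Real.log_le_log (hσ.weight_pos e) (h1.trans h2)
    _ = _ := by rw [Real.log_pow]; norm_num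

/-- The regret to a fixed arm on an interval of rounds, in a form that is linear in the squared
changes of the loss vector: the expert that wakes up at the start of the interval competes with
that arm. -/
theorem interval_regret_le (hK : 2 ≤ K) (hT : 1 ≤ T)
    (hl : ∀ t ∈ Finset.Icc 1 T, ∀ k, l t k ∈ Set.Icc (0 : ℝ) 1) {s n : ℕ} (hs : 1 ≤ s)
    (hsn : s ≤ n) (hn : n ≤ T) (k : Fin K) {lam : ℝ} (hlam : 0 < lam) (hlam1 : lam ≤ 1) :
    ∑ t ∈ Finset.Icc s n, ((∑ i, algDist T l t i * l t i) - l t k)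
      ≤ 100 * (1 + Real.log T)
        * (lam * ∑ t ∈ Finset.Icc s n, ‖lossAt l t - lossAt l (t - 1)‖ ^ 2
          + Real.log K / lam) := by
  have hKT : 2 ≤ K * T := hK.trans (Nat.le_mul_of_pos_right K hT)
  have hE := two_le_card_experts hKT
  obtain ⟨s, rfl⟩ := Nat.exists_eq_add_of_le' hs
  let e : Fin T × Fin K := (⟨s, by omega⟩, k)
  have h1 := sum_regret_add_potential_le hKT hl hn e
  have h2 := ProdState.potential_init_ge hE e
  have h3 := ProdState.potential_le hE (valid_stateAfter hKT l n) e (by norm_num)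
    (log_weight_stateAfter_le hKT hl hn e)
  have h4 := err_stateAfter_le hKT hl hn e
  rw [← Finset.mul_sum] at h4
  have h5 := (valid_stateAfter hKT l n).err_nonneg e
  change ∑ t ∈ Finset.Icc (s + 1) n, ((∑ i, algDist T l t i * l t i) - l t k) + _ ≤ _ at h1
  change _ ≤ 4 * ∑ t ∈ Finset.Icc (s + 1) n, _ at h4
  set D := ∑ t ∈ Finset.Icc (s + 1) n, ‖lossAt l t - lossAt l (t - 1)‖ ^ 2
  set S := (stateAfter T l n).err e
  have hN : Real.log (Fintype.card (Fin T × Fin K)) ≤ 2 * (1 + Real.log T) * Real.log K := by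
    have hK2 : 1 / 2 ≤ Real.log K := by
      simpa using half_le_log_card (E := Fin K) (by simpa using hK)
    have hlT : 0 ≤ Real.log T := Real.log_natCast_nonneg T
    rw [Fintype.card_prod, Fintype.card_fin, Fintype.card_fin, Nat.cast_mul,
      Real.log_mul (by positivity) (by positivity)]
    nlinarith
  have hN2 := half_le_log_card hE
  set n' := Real.log (Fintype.card (Fin T × Fin K))
  have h6 : Real.sqrt n' * Real.sqrt (1 + S) ≤ (lam * (1 + S) + n' / lam) / 2 := by
    have h7 := two_mul_le_add_sq (Real.sqrt (lam * (1 + S))) (Real.sqrt (n' / lam))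
    rw [Real.sq_sqrt (by positivity), Real.sq_sqrt (by positivity), mul_assoc,
      ← Real.sqrt_mul (by positivity)] at h7
    have h8 : lam * (1 + S) * (n' / lam) = n' * (1 + S) := by field_simp
    rw [h8, Real.sqrt_mul (by positivity)] at h7
    linarith
  have h9 : n' ≤ n' / lam := le_div_self (by linarith) hlam hlam1
  have hD : 0 ≤ D := Finset.sum_nonneg fun t _ => by positivity
  have h10 : n' / lam ≤ 2 * (1 + Real.log T) * (Real.log K / lam) := by
    rw [← mul_div_assoc]
    gcongr
  have hlT : 0 ≤ Real.log T := Real.log_natCast_nonneg T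
  have h11 : lam * S ≤ lam * (4 * D) := by gcongr
  have h12 : lam * D ≤ (1 + Real.log T) * (lam * D) :=
    le_mul_of_one_le_left (by positivity) (by linarith)
  -- The coefficients: `16` from the first-order terms, `4` from each of `λ S` and `ln N / λ`.
  rw [mul_add]
  have h13 : lam ≤ 2 * (n' / lam) := by linarith
  nlinarith

end Run

end Sleeping

section MeasurableAlgorithm

variable {T K : ℕ} {Ω : Type*}

/-! ### Measurability of the algorithm -/

section Measurability

variable [MeasurableSpace Ω]

/-- Componentwise measurability of a random state. -/
structure MeasurableState {E : Type*} (σ : Ω → ProdState E) : Prop where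
  weight : ∀ e, Measurable fun ω => (σ ω).weight e
  err : ∀ e, Measurable fun ω => (σ ω).err e

section Prod

variable {E : Type*} [Fintype E] {σ : Ω → ProdState E} {m l : Ω → E → ℝ}

lemma MeasurableState.rate (hσ : MeasurableState σ) (e : E) :
    Measurable fun ω => (σ ω).rate e := by
  have := hσ.err e
  unfold ProdState.rate
  fun_prop

lemma MeasurableState.play (hσ : MeasurableState σ) (hm : ∀ e, Measurable fun ω => m ω e)
    (e : E) : Measurable fun ω => (σ ω).play (m ω) e := by
  have h1 := hσ.weight
  have h2 := hσ.rate
  unfold ProdState.play ProdState.optWeight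
  fun_prop

lemma MeasurableState.instRegret (hσ : MeasurableState σ) (hm : ∀ e, Measurable fun ω => m ω e)
    (hl : ∀ e, Measurable fun ω => l ω e) (e : E) :
    Measurable fun ω => (σ ω).instRegret (m ω) (l ω) e := by
  have h1 := hσ.play hm
  unfold ProdState.instRegret
  fun_prop

lemma MeasurableState.update (hσ : MeasurableState σ) (hm : ∀ e, Measurable fun ω => m ω e)
    (hl : ∀ e, Measurable fun ω => l ω e) :
    MeasurableState fun ω => (σ ω).update (m ω) (l ω) := by
  have h1 := hσ.rate
  have h2 := hσ.instRegret hm hl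
  have h3 := hσ.weight
  have h4 : ∀ e, Measurable fun ω => (σ ω).newErr (m ω) (l ω) e := by
    intro e
    have := hσ.err e
    have := h2 e
    have := hm e
    unfold ProdState.newErr
    fun_prop
  refine ⟨fun e => ?_, h4⟩
  have := h1 e
  have := h2 e
  have := h3 e
  have := hm e
  have : Measurable fun ω => (σ ω).newRate (m ω) (l ω) e :=
    MeasurableState.rate (σ := fun ω => ⟨(σ ω).weight, (σ ω).newErr (m ω) (l ω)⟩) ⟨h3, h4⟩ e
  exact Measurable.pow (by fun_prop) (by fun_prop)

end Prod

/-- A continuous function is positive on `[0, c]` iff it is bounded below by some `1 / (n + 1)` at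
all clamped rationals; this describes the event by countably many conditions. -/
lemma forall_pos_Icc_iff {g : ℝ → ℝ} (hg : Continuous g) {c : ℝ} (hc : 0 ≤ c) :
    (∀ q ∈ Set.Icc 0 c, 0 < g q) ↔ ∃ n : ℕ, ∀ r : ℚ, 1 / ((n : ℝ) + 1) ≤ g (max 0 (min c r)) := by
  have hcl : ∀ x : ℝ, max 0 (min c x) ∈ Set.Icc 0 c := fun x =>
    ⟨le_max_left _ _, max_le hc (min_le_left _ _)⟩
  constructor
  · intro h
    obtain ⟨q, hq, hmin⟩ := isCompact_Icc.exists_isMinOn (Set.nonempty_Icc.2 hc) hg.continuousOn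
    obtain ⟨n, hn⟩ := exists_nat_one_div_lt (h q hq)
    exact ⟨n, fun r => hn.le.trans (hmin (hcl r))⟩
  · rintro ⟨n, hn⟩ q hq
    have h : 1 / ((n : ℝ) + 1) ≤ g (max 0 (min c q)) := by
      refine Rat.denseRange_cast.induction_on (p := fun x : ℝ => 1 / ((n : ℝ) + 1)
        ≤ g (max 0 (min c x))) q ?_ hn
      exact isClosed_le continuous_const (by fun_prop)
    rw [min_eq_right hq.2, max_eq_right hq.1] at h
    exact lt_of_lt_of_le (by positivity) h

section Round

variable {σ : Ω → ProdState (Fin T × Fin K)} {prev cur : Ω → Fin K → ℝ}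

lemma measurable_armDist {q : Ω → Fin T × Fin K → ℝ} (hq : ∀ e, Measurable fun ω => q ω e)
    (t : ℕ) (k : Fin K) : Measurable fun ω => armDist t (q ω) k := by
  have h : ∀ k : Fin K, Measurable fun ω => ∑ s : Fin T,
      if Awake t (s, k) then q ω (s, k) else 0 := by
    intro k
    refine Finset.measurable_fun_sum _ fun s _ => ?_
    split_ifs
    exacts [hq _, measurable_const]
  unfold armDist
  exact (h k).div (Finset.measurable_fun_sum _ fun k _ => h k)

lemma measurable_estimate (hprev : Measurable prev) {α : Ω → ℝ} (hα : Measurable α) (t : ℕ)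
    (e : Fin T × Fin K) : Measurable fun ω => estimate t (prev ω) (α ω) e := by
  unfold estimate
  split_ifs <;> fun_prop

/-- The fixed point exceeds `c` iff `predictedLoss` stays above the diagonal on `[0, c]`. -/
lemma lt_fixedPoint_iff (hKT : 2 ≤ K * T) {t : ℕ} (ht : 1 ≤ t) {prev : Fin K → ℝ}
    (hprev : ∀ k, prev k ∈ Set.Icc (0 : ℝ) 1) {σ : ProdState (Fin T × Fin K)} (hσ : σ.Valid)
    (c : ℝ) : c < fixedPoint t prev σ ↔ ∀ q ∈ Set.Icc 0 c, 0 < predictedLoss t prev σ q - q := by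
  have hfp := fixedPoint_mem hKT ht hprev hσ
  have hcont := continuous_predictedLoss hKT ht prev hσ
  have hm := predictedLoss_mem_Icc hKT ht hprev hσ
  constructor
  · intro hc q hq
    by_contra! hle
    obtain ⟨x, hx, hx0⟩ := intermediate_value_Icc' (f := fun α => predictedLoss t prev σ α - α)
      hq.1 (by fun_prop : Continuous _).continuousOn
      (show (0 : ℝ) ∈ Set.Icc _ _ from ⟨hle, by linarith [(hm 0).1]⟩)
    have hx1 : x ≤ 1 := hx.2.trans (hq.2.trans (hc.le.trans hfp.1.2))
    have : fixedPoint t prev σ ≤ x :=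
      csInf_le ⟨0, fun α hα => hα.1.1⟩ ⟨⟨hx.1, hx1⟩, sub_eq_zero.1 hx0⟩
    linarith [hx.2, hq.2]
  · intro h
    by_contra! hle
    have := h _ ⟨hfp.1.1, hle⟩
    rw [hfp.2] at this
    linarith

lemma measurable_fixedPoint (hKT : 2 ≤ K * T) {t : ℕ} (ht : 1 ≤ t) (hprev : Measurable prev)
    (hprev' : ∀ ω k, prev ω k ∈ Set.Icc (0 : ℝ) 1) (hσ : MeasurableState σ)
    (hσ' : ∀ ω, (σ ω).Valid) : Measurable fun ω => fixedPoint t (prev ω) (σ ω) := by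
  have hpl : ∀ α : ℝ, Measurable fun ω => predictedLoss t (prev ω) (σ ω) α := by
    intro α
    have h := measurable_armDist (hσ.play fun e => measurable_estimate hprev
      (measurable_const (a := α)) t e) t
    unfold predictedLoss
    exact Finset.measurable_fun_sum _ fun k _ => (h k).mul (measurable_pi_apply k |>.comp hprev)
  refine measurable_of_Ioi fun c => ?_
  have hset : (fun ω => fixedPoint t (prev ω) (σ ω)) ⁻¹' Set.Ioi c
      = {ω | ∀ q ∈ Set.Icc 0 c, 0 < predictedLoss t (prev ω) (σ ω) q - q} := by
    ext ω
    exact lt_fixedPoint_iff hKT ht (hprev' ω) (hσ' ω) c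
  rw [hset]
  rcases lt_or_ge c 0 with hc | hc
  · simp [Set.Icc_eq_empty (not_le.2 hc)]
  · have hset' : {ω | ∀ q ∈ Set.Icc 0 c, 0 < predictedLoss t (prev ω) (σ ω) q - q}
        = ⋃ n : ℕ, ⋂ r : ℚ, {ω | 1 / ((n : ℝ) + 1)
          ≤ predictedLoss t (prev ω) (σ ω) (max 0 (min c r)) - max 0 (min c r)} := by
      ext ω
      have hcont := continuous_predictedLoss hKT ht (prev ω) (hσ' ω)
      simp only [Set.mem_ofPred_eq, Set.mem_iUnion, Set.mem_iInter]
      exact forall_pos_Icc_iff (g := fun q => predictedLoss t (prev ω) (σ ω) q - q)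
        (by fun_prop) hc
    rw [hset']
    exact MeasurableSet.iUnion fun n => MeasurableSet.iInter fun r =>
      measurableSet_le measurable_const ((hpl _).sub_const _)

lemma measurable_roundEstimate (hKT : 2 ≤ K * T) {t : ℕ} (ht : 1 ≤ t) (hprev : Measurable prev)
    (hprev' : ∀ ω k, prev ω k ∈ Set.Icc (0 : ℝ) 1) (hσ : MeasurableState σ)
    (hσ' : ∀ ω, (σ ω).Valid) (e : Fin T × Fin K) :
    Measurable fun ω => roundEstimate t (prev ω) (σ ω) e :=
  measurable_estimate hprev (measurable_fixedPoint hKT ht hprev hprev' hσ hσ') t e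

lemma measurable_roundDist (hKT : 2 ≤ K * T) {t : ℕ} (ht : 1 ≤ t) (hprev : Measurable prev)
    (hprev' : ∀ ω k, prev ω k ∈ Set.Icc (0 : ℝ) 1) (hσ : MeasurableState σ)
    (hσ' : ∀ ω, (σ ω).Valid) (k : Fin K) :
    Measurable fun ω => roundDist t (prev ω) (σ ω) k :=
  measurable_armDist (hσ.play (measurable_roundEstimate hKT ht hprev hprev' hσ hσ')) t k

lemma measurable_roundLoss (hKT : 2 ≤ K * T) {t : ℕ} (ht : 1 ≤ t) (hprev : Measurable prev)
    (hprev' : ∀ ω k, prev ω k ∈ Set.Icc (0 : ℝ) 1) (hcur : Measurable cur)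
    (hσ : MeasurableState σ) (hσ' : ∀ ω, (σ ω).Valid) (e : Fin T × Fin K) :
    Measurable fun ω => roundLoss t (prev ω) (cur ω) (σ ω) e := by
  have h := measurable_roundDist hKT ht hprev hprev' hσ hσ'
  unfold roundLoss
  split_ifs <;> fun_prop

end Round

variable {l : ℕ → Ω → Fin K → ℝ}

lemma measurable_lossAt {n : ℕ} (hl : ∀ t ∈ Finset.Icc 1 n, Measurable (l t)) :
    Measurable fun ω => lossAt (fun s => l s ω) n := by
  cases n with
  | zero => exact measurable_const
  | succ n => exact hl (n + 1) (Finset.mem_Icc.2 ⟨by omega, le_rfl⟩)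

lemma measurableState_stateAfter (hKT : 2 ≤ K * T)
    (hl' : ∀ t ∈ Finset.Icc 1 T, ∀ ω k, l t ω k ∈ Set.Icc (0 : ℝ) 1) {n : ℕ} (hn : n ≤ T)
    (hl : ∀ t ∈ Finset.Icc 1 n, Measurable (l t)) :
    MeasurableState fun ω => stateAfter T (fun s => l s ω) n := by
  induction n with
  | zero => exact ⟨fun _ => measurable_const, fun _ => measurable_const⟩
  | succ n ih =>
    have hl0 : ∀ t ∈ Finset.Icc 1 n, Measurable (l t) := fun t ht =>
      hl t (Finset.Icc_subset_Icc_right (Nat.le_succ n) ht)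
    have ih := ih (by omega) hl0
    have hprev := measurable_lossAt hl0
    have hprev' : ∀ ω k, lossAt (fun s => l s ω) n k ∈ Set.Icc (0 : ℝ) 1 := fun ω k =>
      lossAt_mem_Icc (fun t ht => hl' t ht ω) (by omega) k
    have hσ' : ∀ ω, (stateAfter T (fun s => l s ω) n).Valid := fun ω => valid_stateAfter hKT _ n
    exact ih.update (measurable_roundEstimate hKT (by omega) hprev hprev' ih hσ')
      (measurable_roundLoss hKT (by omega) hprev hprev'
        (hl (n + 1) (Finset.mem_Icc.2 ⟨by omega, le_rfl⟩)) ih hσ')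

lemma measurable_algDist_succ (hKT : 2 ≤ K * T)
    (hl' : ∀ t ∈ Finset.Icc 1 T, ∀ ω k, l t ω k ∈ Set.Icc (0 : ℝ) 1) {n : ℕ} (hn : n ≤ T)
    (hl : ∀ t ∈ Finset.Icc 1 n, Measurable (l t)) (k : Fin K) :
    Measurable fun ω => algDist T (fun s => l s ω) (n + 1) k :=
  measurable_roundDist hKT (by omega) (measurable_lossAt hl)
    (fun ω k => lossAt_mem_Icc (fun t ht => hl' t ht ω) hn k)
    (measurableState_stateAfter hKT hl' hn hl) (fun _ => valid_stateAfter hKT _ n) k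

end Measurability

end MeasurableAlgorithm

section Expectation

open MeasureTheory ProbabilityTheory

/-! ### Expectations -/

lemma measurable_history {K : ℕ} {Ω : Type*} {l : ℕ → Ω → Fin K → ℝ} {s t : ℕ}
    (hs : s ∈ Finset.Icc 1 t) : Measurable[history l t] (l s) :=
  measurable_iff_comap_le.2
    (le_iSup₂_of_le (f := fun s (_ : s ∈ Finset.Icc 1 t) =>
      MeasurableSpace.comap (l s) inferInstance) s hs le_rfl)

variable {T K : ℕ} {Ω : Type*} [MeasurableSpace Ω] {P : Measure Ω} {l : ℕ → Ω → Fin K → ℝ}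
  {a : ℕ → Ω → Fin K}

lemma mean_of_pos (P : Measure Ω) (l : ℕ → Ω → Fin K → ℝ) {t : ℕ} (ht : 1 ≤ t) (k : Fin K) :
    mean P l t k = ∫ ω, l t ω k ∂P := by
  obtain ⟨t, rfl⟩ := Nat.exists_eq_add_of_le' ht
  rfl

lemma IsEnvironment.measurable_apply (h : IsEnvironment P T l) {t : ℕ} (ht : t ∈ Finset.Icc 1 T)
    (k : Fin K) : Measurable fun ω => l t ω k :=
  (measurable_pi_apply k).comp (h.measurable t ht)

lemma IsEnvironment.history_le (h : IsEnvironment P T l) {t : ℕ} (ht : t ≤ T) :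
    history l t ≤ ‹MeasurableSpace Ω› := by
  refine iSup₂_le fun s hs => ?_
  rw [Finset.mem_Icc] at hs
  exact (h.measurable s (Finset.mem_Icc.2 ⟨hs.1, hs.2.trans ht⟩)).comap_le

/-- `p_t` is determined by the losses before round `t`. -/
lemma IsEnvironment.measurable_algDist_history (h : IsEnvironment P T l) (hKT : 2 ≤ K * T) {t : ℕ}
    (ht : t ∈ Finset.Icc 1 T) (k : Fin K) :
    Measurable[history l (t - 1)] fun ω => algDist T (fun s => l s ω) t k := by
  rw [Finset.mem_Icc] at ht
  obtain ⟨t, rfl⟩ := Nat.exists_eq_add_of_le' ht.1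
  exact @measurable_algDist_succ T K Ω (history l t) l hKT h.mem_Icc t (by omega)
    (fun s hs => measurable_history hs) k

lemma IsEnvironment.measurable_algDist (h : IsEnvironment P T l) (hKT : 2 ≤ K * T) {t : ℕ}
    (ht : t ∈ Finset.Icc 1 T) (k : Fin K) :
    Measurable fun ω => algDist T (fun s => l s ω) t k := by
  have ht' := Finset.mem_Icc.1 ht
  exact (h.measurable_algDist_history hKT ht k).mono (h.history_le (by omega)) le_rfl

lemma IsEnvironment.indep_history (h : IsEnvironment P T l) {t : ℕ} (ht : t ∈ Finset.Icc 1 T) :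
    Indep (history l (t - 1)) (MeasurableSpace.comap (l t) inferInstance) P := by
  have ht' := Finset.mem_Icc.1 ht
  have hind := indep_iSup_of_disjoint (ι := Finset.Icc 1 T)
    (m := fun s => MeasurableSpace.comap (l s) inferInstance)
    (S := {s | (s : ℕ) ≤ t - 1}) (T := {⟨t, ht⟩})
    (fun s => (h.measurable s s.2).comap_le) h.indep (by
      rw [Set.disjoint_singleton_right]
      intro h
      have : t ≤ t - 1 := h
      omega)
  refine indep_of_indep_of_le hind ?_ ?_
  · refine iSup₂_le fun s hs => ?_
    rw [Finset.mem_Icc] at hs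
    exact le_iSup₂_of_le (f := fun (s : Finset.Icc 1 T)
      (_ : s ∈ {s : Finset.Icc 1 T | (s : ℕ) ≤ t - 1}) =>
        MeasurableSpace.comap (l s) inferInstance)
      ⟨s, Finset.mem_Icc.2 ⟨hs.1, by omega⟩⟩ hs.2 le_rfl
  · exact le_iSup₂_of_le (f := fun (s : Finset.Icc 1 T) (_ : s ∈ {(⟨t, ht⟩ : Finset.Icc 1 T)})
      => MeasurableSpace.comap (l s) inferInstance) ⟨t, ht⟩ rfl le_rfl

lemma integrable_of_mem_Icc [IsProbabilityMeasure P] {f : Ω → ℝ} (hf : Measurable f) {b : ℝ}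
    (hb : ∀ ω, f ω ∈ Set.Icc (0 : ℝ) b) : Integrable f P :=
  Integrable.of_bound hf.aestronglyMeasurable b (ae_of_all _ fun ω => by
    rw [Real.norm_eq_abs, abs_of_nonneg (hb ω).1]
    exact (hb ω).2)

/-- The expected loss `⟨p_t, ℓ_t⟩` of round `t` given the losses. -/
def playedLoss (T : ℕ) (l : ℕ → Ω → Fin K → ℝ) (t : ℕ) (ω : Ω) : ℝ :=
  ∑ k, algDist T (fun s => l s ω) t k * l t ω k

lemma IsEnvironment.measurable_lossAt_fun (h : IsEnvironment P T l) {t : ℕ} (ht : t ≤ T) :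
    Measurable fun ω => lossAt (fun s => l s ω) t :=
  measurable_lossAt fun s hs => h.measurable s (Finset.Icc_subset_Icc_right ht hs)

section Prob

variable [IsProbabilityMeasure P]

lemma IsEnvironment.integrable_apply (h : IsEnvironment P T l) {t : ℕ} (ht : t ∈ Finset.Icc 1 T)
    (k : Fin K) : Integrable (fun ω => l t ω k) P :=
  integrable_of_mem_Icc (h.measurable_apply ht k) fun ω => h.mem_Icc t ht ω k

lemma IsEnvironment.integrable_algDist_mul (h : IsEnvironment P T l) (hKT : 2 ≤ K * T) {t : ℕ}
    (ht : t ∈ Finset.Icc 1 T) (k : Fin K) :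
    Integrable (fun ω => algDist T (fun s => l s ω) t k * l t ω k) P := by
  refine integrable_of_mem_Icc (b := 1)
    ((h.measurable_algDist hKT ht k).mul (h.measurable_apply ht k)) fun ω => ?_
  have h1 := algDist_nonneg hKT (fun s => l s ω) t k
  have h2 := algDist_le_one hKT (fun s => l s ω) (Finset.mem_Icc.1 ht).1 k
  have h3 := h.mem_Icc t ht ω k
  exact ⟨mul_nonneg h1 h3.1, mul_le_one₀ h2 h3.1 h3.2⟩

lemma IsEnvironment.integrable_playedLoss (h : IsEnvironment P T l) (hKT : 2 ≤ K * T) {t : ℕ}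
    (ht : t ∈ Finset.Icc 1 T) : Integrable (playedLoss T l t) P :=
  integrable_finsetSum _ fun k _ => h.integrable_algDist_mul hKT ht k

/-- The expected loss of the drawn arm, by conditioning on the losses up to round `t`. -/
lemma integral_loss_play (h : IsEnvironment P T l) (ha : IsPlayOf P T l a) (hKT : 2 ≤ K * T)
    {t : ℕ} (ht : t ∈ Finset.Icc 1 T) :
    ∫ ω, l t ω (a t ω) ∂P = ∫ ω, playedLoss T l t ω ∂P := by
  have ht' := Finset.mem_Icc.1 ht
  have hset : ∀ k, MeasurableSet {ω | a t ω = k} := fun k =>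
    ha.measurable t ht (measurableSet_singleton k)
  have hi : ∀ k, Integrable (Set.indicator {ω | a t ω = k} fun _ => (1 : ℝ)) P := fun k =>
    (integrable_const 1).indicator (hset k)
  have hprod : ∀ k, Integrable ((Set.indicator {ω | a t ω = k} fun _ => (1 : ℝ))
      * fun ω => l t ω k) P := by
    intro k
    refine integrable_of_mem_Icc (b := 1)
      ((measurable_const.indicator (hset k)).mul (h.measurable_apply ht k)) fun ω => ?_
    have h3 := h.mem_Icc t ht ω k
    by_cases hω : a t ω = k
    · simpa [Set.indicator, hω] using h3
    · simp [Set.indicator, hω]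
  have hk : ∀ k, ∫ ω, ((Set.indicator {ω | a t ω = k} fun _ => (1 : ℝ)) * fun ω => l t ω k) ω ∂P
      = ∫ ω, algDist T (fun s => l s ω) t k * l t ω k ∂P := by
    intro k
    have hsm : StronglyMeasurable[history l t] fun ω => l t ω k := by
      refine Measurable.stronglyMeasurable ?_
      exact (measurable_pi_apply k).comp
        (measurable_history (Finset.mem_Icc.2 ⟨ht'.1, le_rfl⟩))
    rw [← integral_condExp (h.history_le ht'.2)]
    refine integral_congr_ae ?_
    filter_upwards [condExp_mul_of_stronglyMeasurable_right hsm (hprod k) (hi k),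
      ha.law t ht k] with ω h1 h2
    rw [h1, Pi.mul_apply, h2]
  have hsum : ∀ ω, l t ω (a t ω)
      = ∑ k, ((Set.indicator {ω | a t ω = k} fun _ => (1 : ℝ)) * fun ω => l t ω k) ω := by
    intro ω
    simp [Set.indicator]
  simp_rw [hsum]
  rw [integral_finsetSum _ fun k _ => hprod k]
  unfold playedLoss
  rw [integral_finsetSum _ fun k _ => h.integrable_algDist_mul hKT ht k]
  exact Finset.sum_congr rfl fun k _ => hk k

/-- Independence makes the expected loss of a round an average of the means. -/
lemma IsEnvironment.integral_playedLoss_eq (h : IsEnvironment P T l) (hKT : 2 ≤ K * T) {t : ℕ}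
    (ht : t ∈ Finset.Icc 1 T) :
    ∫ ω, playedLoss T l t ω ∂P
      = ∑ k, (∫ ω, algDist T (fun s => l s ω) t k ∂P) * mean P l t k := by
  unfold playedLoss
  rw [integral_finsetSum _ fun k _ => h.integrable_algDist_mul hKT ht k]
  refine Finset.sum_congr rfl fun k _ => ?_
  have hind : IndepFun (fun ω => algDist T (fun s => l s ω) t k) (fun ω => l t ω k) P :=
    indep_of_indep_of_le (h.indep_history ht)
      (h.measurable_algDist_history hKT ht k).comap_le (by
        rw [← measurable_iff_comap_le]
        exact (measurable_pi_apply k).comp (comap_measurable (l t)))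
  rw [hind.integral_fun_mul_eq_mul_integral
    (h.measurable_algDist hKT ht k).aestronglyMeasurable
    (h.measurable_apply ht k).aestronglyMeasurable, mean_of_pos P l (Finset.mem_Icc.1 ht).1]

lemma IsEnvironment.integral_playedLoss_le (h : IsEnvironment P T l) (hKT : 2 ≤ K * T) {t : ℕ}
    (ht : t ∈ Finset.Icc 1 T) : ∫ ω, playedLoss T l t ω ∂P ≤ ‖mean P l t‖ := by
  rw [h.integral_playedLoss_eq hKT ht]
  have ht1 := (Finset.mem_Icc.1 ht).1
  have hint : ∀ k, Integrable (fun ω => algDist T (fun s => l s ω) t k) P := fun k =>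
    integrable_of_mem_Icc (h.measurable_algDist hKT ht k) fun ω =>
      ⟨algDist_nonneg hKT _ t k, algDist_le_one hKT _ ht1 k⟩
  calc _ ≤ ∑ k, (∫ ω, algDist T (fun s => l s ω) t k ∂P) * ‖mean P l t‖ := by
        refine Finset.sum_le_sum fun k _ => mul_le_mul_of_nonneg_left ?_
          (integral_nonneg fun ω => algDist_nonneg hKT _ t k)
        exact (le_abs_self _).trans (norm_le_pi_norm (mean P l t) k)
    _ = _ := by
      rw [← Finset.sum_mul, ← integral_finsetSum _ fun k _ => hint k]
      simp_rw [sum_algDist hKT _ ht1]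
      simp

lemma IsEnvironment.mean_mem_Icc (h : IsEnvironment P T l) {t : ℕ} (ht : t ≤ T)
    (k : Fin K) : mean P l t k ∈ Set.Icc (0 : ℝ) 1 := by
  cases t with
  | zero => exact ⟨le_rfl, zero_le_one⟩
  | succ t =>
    have ht' : t + 1 ∈ Finset.Icc 1 T := Finset.mem_Icc.2 ⟨by omega, ht⟩
    refine ⟨integral_nonneg fun ω => (h.mem_Icc _ ht' ω k).1, ?_⟩
    have := integral_mono (h.integrable_apply ht' k) (integrable_const (1 : ℝ))
      fun ω => (h.mem_Icc _ ht' ω k).2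
    simpa [mean] using this

/-- `E ‖ℓ_t - μ_t‖_2²`, which is `0` for `t = 0`. -/
def varianceAt (P : Measure Ω) (l : ℕ → Ω → Fin K → ℝ) (t : ℕ) : ℝ :=
  ∫ ω, ∑ i, (lossAt (fun s => l s ω) t i - mean P l t i) ^ 2 ∂P

/-- The squared change `‖ℓ_t - ℓ_{t-1}‖_∞²` of the loss vector. -/
def sqChange (l : ℕ → Ω → Fin K → ℝ) (t : ℕ) (ω : Ω) : ℝ :=
  ‖lossAt (fun s => l s ω) t - lossAt (fun s => l s ω) (t - 1)‖ ^ 2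

lemma varianceAt_zero (P : Measure Ω) (l : ℕ → Ω → Fin K → ℝ) : varianceAt P l 0 = 0 := by
  simp [varianceAt, lossAt, mean]

lemma varianceAt_nonneg (P : Measure Ω) (l : ℕ → Ω → Fin K → ℝ) (t : ℕ) : 0 ≤ varianceAt P l t :=
  integral_nonneg fun _ => Finset.sum_nonneg fun _ _ => sq_nonneg _

lemma totalVariance_eq (P : Measure Ω) (T : ℕ) (l : ℕ → Ω → Fin K → ℝ) :
    totalVariance P T l = ∑ t ∈ Finset.Icc 1 T, varianceAt P l t := by
  refine Finset.sum_congr rfl fun t ht => ?_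
  unfold varianceAt
  simp_rw [lossAt_of_pos _ (Finset.mem_Icc.1 ht).1]

lemma IsEnvironment.integrable_sqChange (h : IsEnvironment P T l) {t : ℕ} (ht : t ≤ T) :
    Integrable (sqChange l t) P := by
  have h1 := h.measurable_lossAt_fun ht
  have h2 := h.measurable_lossAt_fun (t := t - 1) (by omega)
  refine integrable_of_mem_Icc (b := 1) ((h1.sub h2).norm.pow_const 2) fun ω => ?_
  have := norm_sub_le_one
    (fun k => lossAt_mem_Icc (fun s hs => h.mem_Icc s hs ω) (by omega : t - 1 ≤ T) k)
    (fun k => lossAt_mem_Icc (fun s hs => h.mem_Icc s hs ω) ht k)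
  exact ⟨sq_nonneg _, pow_le_one₀ (norm_nonneg _) this⟩

lemma IsEnvironment.integrable_sqDev (h : IsEnvironment P T l) {t : ℕ} (ht : t ≤ T) :
    Integrable (fun ω => ∑ i, (lossAt (fun s => l s ω) t i - mean P l t i) ^ 2) P := by
  have h1 := h.measurable_lossAt_fun ht
  refine integrable_finsetSum _ fun i _ => integrable_of_mem_Icc (b := 1)
    ((((measurable_pi_apply i).comp h1).sub_const _).pow_const 2) fun ω => ⟨sq_nonneg _, ?_⟩
  have h2 := lossAt_mem_Icc (fun s hs => h.mem_Icc s hs ω) ht i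
  have h3 := h.mean_mem_Icc ht i
  simp only [Set.mem_Icc] at h2 h3
  exact (sq_le_one_iff_abs_le_one _).2 (abs_le.2 ⟨by linarith, by linarith⟩)

lemma norm_sq_le_sum_sq (x : Fin K → ℝ) : ‖x‖ ^ 2 ≤ ∑ i, x i ^ 2 := by
  have h0 : 0 ≤ ∑ i, x i ^ 2 := Finset.sum_nonneg fun i _ => sq_nonneg _
  have h : ‖x‖ ≤ Real.sqrt (∑ i, x i ^ 2) := by
    refine (pi_norm_le_iff_of_nonneg (Real.sqrt_nonneg _)).2 fun i => ?_
    rw [Real.norm_eq_abs]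
    exact Real.abs_le_sqrt (Finset.single_le_sum (f := fun i => x i ^ 2)
      (fun i _ => sq_nonneg _) (Finset.mem_univ i))
  calc ‖x‖ ^ 2 ≤ Real.sqrt (∑ i, x i ^ 2) ^ 2 := by gcongr
    _ = _ := Real.sq_sqrt h0

lemma IsEnvironment.integral_sqChange_le (h : IsEnvironment P T l) {t : ℕ} (ht : t ≤ T) :
    ∫ ω, sqChange l t ω ∂P ≤ 3 * (varianceAt P l t + varianceAt P l (t - 1)
      + ‖mean P l t - mean P l (t - 1)‖ ^ 2) := by
  have i1 := h.integrable_sqDev ht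
  have i2 := h.integrable_sqDev (t := t - 1) (by omega)
  have hle : ∀ ω, sqChange l t ω ≤ 3 * ((∑ i, (lossAt (fun s => l s ω) t i - mean P l t i) ^ 2)
      + (∑ i, (lossAt (fun s => l s ω) (t - 1) i - mean P l (t - 1) i) ^ 2)
      + ‖mean P l t - mean P l (t - 1)‖ ^ 2) := by
    intro ω
    unfold sqChange
    set x := lossAt (fun s => l s ω) t
    set y := lossAt (fun s => l s ω) (t - 1)
    have h1 := norm_sq_le_sum_sq (x - mean P l t)
    have h2 := norm_sq_le_sum_sq (y - mean P l (t - 1))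
    simp only [Pi.sub_apply] at h1 h2
    have h3 : ‖x - y‖ ≤ ‖x - mean P l t‖ + ‖y - mean P l (t - 1)‖
        + ‖mean P l t - mean P l (t - 1)‖ := by
      have : x - y = (x - mean P l t) - (y - mean P l (t - 1))
          + (mean P l t - mean P l (t - 1)) := by abel
      rw [this]
      exact (norm_add_le _ _).trans (add_le_add_left (norm_sub_le _ _) _)
    have h4 : ‖x - y‖ ^ 2 ≤ (‖x - mean P l t‖ + ‖y - mean P l (t - 1)‖
        + ‖mean P l t - mean P l (t - 1)‖) ^ 2 := by gcongr
    nlinarith [sq_nonneg (‖x - mean P l t‖ - ‖y - mean P l (t - 1)‖),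
      sq_nonneg (‖x - mean P l t‖ - ‖mean P l t - mean P l (t - 1)‖),
      sq_nonneg (‖y - mean P l (t - 1)‖ - ‖mean P l t - mean P l (t - 1)‖)]
  refine (integral_mono (h.integrable_sqChange ht) ?_ hle).trans_eq ?_
  · exact ((i1.add i2).add (integrable_const _)).const_mul 3
  · rw [integral_const_mul, integral_add (by exact i1.add i2) (integrable_const _),
      integral_add i1 i2]
    simp [varianceAt]

lemma IsEnvironment.sum_integral_sqChange_le (h : IsEnvironment P T l) :
    ∑ t ∈ Finset.Icc 1 T, ∫ ω, sqChange l t ω ∂P ≤ 6 * totalVariance P T l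
      + 3 * ∑ t ∈ Finset.Icc 1 T, ‖mean P l t - mean P l (t - 1)‖ ^ 2 := by
  have hshift : ∀ n, ∑ t ∈ Finset.Icc 1 n, varianceAt P l (t - 1)
      ≤ ∑ t ∈ Finset.Icc 1 n, varianceAt P l t := by
    intro n
    -- The difference of the two sides is `varianceAt P l n`.
    have : ∑ t ∈ Finset.Icc 1 n, varianceAt P l (t - 1) + varianceAt P l n
        = ∑ t ∈ Finset.Icc 1 n, varianceAt P l t := by
      induction n with
      | zero => simp [varianceAt_zero]
      | succ n ih =>
        rw [Finset.sum_Icc_succ_top (by omega), Finset.sum_Icc_succ_top (by omega), ← ih,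
          Nat.add_sub_cancel]
    linarith [varianceAt_nonneg P l n]
  calc _ ≤ ∑ t ∈ Finset.Icc 1 T, 3 * (varianceAt P l t + varianceAt P l (t - 1)
      + ‖mean P l t - mean P l (t - 1)‖ ^ 2) :=
        Finset.sum_le_sum fun t ht => h.integral_sqChange_le (Finset.mem_Icc.1 ht).2
    _ ≤ _ := by
      rw [totalVariance_eq, ← Finset.mul_sum, Finset.sum_add_distrib, Finset.sum_add_distrib]
      linarith [hshift T]

lemma IsEnvironment.interval_regret_le (h : IsEnvironment P T l) (hK : 2 ≤ K) (hT : 1 ≤ T)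
    {s n : ℕ} (hs : 1 ≤ s) (hsn : s ≤ n) (hn : n ≤ T) (k : Fin K) {lam : ℝ} (hlam : 0 < lam)
    (hlam1 : lam ≤ 1) :
    ∑ t ∈ Finset.Icc s n, ((∫ ω, playedLoss T l t ω ∂P) - mean P l t k)
      ≤ ∑ t ∈ Finset.Icc s n, 100 * (1 + Real.log T) * lam * (∫ ω, sqChange l t ω ∂P)
        + 100 * (1 + Real.log T) * (Real.log K / lam) := by
  have hKT : 2 ≤ K * T := hK.trans (Nat.le_mul_of_pos_right K hT)
  have hmem : ∀ t ∈ Finset.Icc s n, t ∈ Finset.Icc 1 T := fun t ht =>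
    Finset.Icc_subset_Icc hs hn ht
  have hpt := fun ω => NonstationaryExperts.interval_regret_le hK hT
    (fun t ht => h.mem_Icc t ht ω) hs hsn hn k hlam hlam1
  have i1 : ∀ t ∈ Finset.Icc s n, Integrable (fun ω => playedLoss T l t ω - l t ω k) P :=
    fun t ht => (h.integrable_playedLoss hKT (hmem t ht)).sub (h.integrable_apply (hmem t ht) k)
  have i2 : ∀ t ∈ Finset.Icc s n, Integrable (sqChange l t) P := fun t ht =>
    h.integrable_sqChange (Finset.mem_Icc.1 (hmem t ht)).2
  have hint := integral_mono (integrable_finsetSum _ i1)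
    ((((integrable_finsetSum _ i2).const_mul lam).add
      (integrable_const (Real.log K / lam))).const_mul (100 * (1 + Real.log T))) hpt
  rw [integral_finsetSum _ i1, integral_const_mul] at hint
  simp only [Pi.add_apply] at hint
  rw [integral_add ((integrable_finsetSum _ i2).const_mul lam) (integrable_const _),
    integral_const_mul, integral_finsetSum _ i2] at hint
  have hl : ∑ t ∈ Finset.Icc s n, ((∫ ω, playedLoss T l t ω ∂P) - mean P l t k)
      = ∑ t ∈ Finset.Icc s n, ∫ ω, (playedLoss T l t ω - l t ω k) ∂P := by
    refine Finset.sum_congr rfl fun t ht => ?_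
    rw [integral_sub (h.integrable_playedLoss hKT (hmem t ht)) (h.integrable_apply (hmem t ht) k),
      mean_of_pos P l (Finset.mem_Icc.1 (hmem t ht)).1]
  rw [hl]
  refine hint.trans_eq ?_
  rw [← Finset.mul_sum]
  simp
  ring

end Prob

end Expectation

section Comparators

open MeasureTheory ProbabilityTheory

/-! ### From intervals to sequences of comparators -/

/-- Regret bounds on all intervals against fixed comparators add up to a bound against a moving
comparator `κ`, with one additive constant for every constant piece of `κ`. -/
lemma sum_le_of_interval_le {ι : Type*} [DecidableEq ι] {F : ℕ → ι → ℝ} {D : ℕ → ℝ} {c : ℝ}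
    {T : ℕ} (hT : 1 ≤ T)
    (hF : ∀ s n, 1 ≤ s → s ≤ n → n ≤ T → ∀ k,
      ∑ t ∈ Finset.Icc s n, F t k ≤ ∑ t ∈ Finset.Icc s n, D t + c) (κ : ℕ → ι) :
    ∑ t ∈ Finset.Icc 1 T, F t (κ t) ≤ ∑ t ∈ Finset.Icc 1 T, D t
      + (1 + ∑ t ∈ Finset.Icc 2 T, if κ t ≠ κ (t - 1) then (1 : ℝ) else 0) * c := by
  -- The induction over `n` continues the last piece of `κ` on `[1, n]` up to an arbitrary round `e`.
  have key : ∀ n, 1 ≤ n → ∀ e, n ≤ e → e ≤ T →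
      ∑ t ∈ Finset.Icc 1 n, F t (κ t) + ∑ t ∈ Finset.Icc (n + 1) e, F t (κ n)
        ≤ ∑ t ∈ Finset.Icc 1 e, D t
          + (1 + ∑ t ∈ Finset.Icc 2 n, if κ t ≠ κ (t - 1) then (1 : ℝ) else 0) * c := by
    have split : ∀ (f : ℕ → ℝ) (n e : ℕ), n ≤ e →
        ∑ t ∈ Finset.Icc (n + 1) e, f t
          = ∑ t ∈ Finset.Icc 1 e, f t - ∑ t ∈ Finset.Icc 1 n, f t := by
      intro f n e hne
      induction e, hne using Nat.le_induction with
      | base => simp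
      | succ e hne ih =>
        rw [Finset.sum_Icc_succ_top (by omega), Finset.sum_Icc_succ_top (by omega), ih]
        ring
    intro n hn
    induction n, hn using Nat.le_induction with
    | base =>
      intro e he heT
      rw [split _ 1 e he]
      simpa using hF 1 e le_rfl he heT (κ 1)
    | succ n hn ih =>
      intro e he heT
      rw [Finset.sum_Icc_succ_top (by omega : 1 ≤ n + 1),
        Finset.sum_Icc_succ_top (by omega : 2 ≤ n + 1), Nat.add_sub_cancel]
      by_cases hκ : κ (n + 1) = κ n
      · have h := ih e (by omega) heT
        rw [split _ n e (by omega)] at h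
        rw [split _ (n + 1) e he, Finset.sum_Icc_succ_top (by omega), hκ]
        simp only [ne_eq, not_true_eq_false, if_false, add_zero] at h ⊢
        linarith
      · have h := ih n le_rfl (by omega)
        rw [split _ n n le_rfl] at h
        have h2 := hF (n + 1) e (by omega) he heT (κ (n + 1))
        rw [split _ n e (by omega), split _ n e (by omega)] at h2
        rw [split _ (n + 1) e he, Finset.sum_Icc_succ_top (by omega), if_pos hκ]
        linarith
  simpa using key T hT T le_rfl le_rfl

/-- Optimizing the free parameter of a linearized square-root bound, with
`λ = √Y / (√X + √Y)`. -/
lemma le_of_forall_lam {R X Y : ℝ} (hX : 0 ≤ X) (hY : 0 < Y)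
    (h : ∀ lam : ℝ, 0 < lam → lam ≤ 1 → R ≤ lam * X + Y / lam) :
    R ≤ 2 * Real.sqrt (X * Y) + Y := by
  have hx := Real.sqrt_nonneg X
  have hy := Real.sqrt_pos.2 hY
  have hx2 := Real.mul_self_sqrt hX
  have hy2 := Real.mul_self_sqrt hY.le
  rw [Real.sqrt_mul hX]
  set x := Real.sqrt X
  set y := Real.sqrt Y
  have hxy : 0 < x + y := by linarith
  refine (h (y / (x + y)) (by positivity) ((div_le_one hxy).2 (by linarith))).trans ?_
  have h1 : y / (x + y) * X ≤ x * y := by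
    rw [div_mul_eq_mul_div, div_le_iff₀ hxy, ← hx2]
    nlinarith [mul_nonneg hx (mul_pos hy hy).le]
  have h2 : Y / (y / (x + y)) = y * x + Y := by
    rw [← hy2]
    field_simp
  linarith

lemma exists_argmin {K : ℕ} (hK : 0 < K) :
    ∃ f : (Fin K → ℝ) → Fin K, ∀ x : Fin K → ℝ, x (f x) = ⨅ i, x i := by
  have : Nonempty (Fin K) := ⟨⟨0, hK⟩⟩
  choose f hf using fun x : Fin K → ℝ => exists_eq_ciInf_of_finite (f := x)
  exact ⟨f, hf⟩

variable {T K : ℕ} {Ω : Type*} [MeasurableSpace Ω] {P : Measure Ω} {l : ℕ → Ω → Fin K → ℝ}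
  {a : ℕ → Ω → Fin K}

lemma half_le_log_of_two_le (hK : 2 ≤ K) : 1 / 2 ≤ Real.log K := by
  simpa using half_le_log_card (E := Fin K) (by simpa using hK)

lemma totalVariance_nonneg (P : Measure Ω) (T : ℕ) (l : ℕ → Ω → Fin K → ℝ) :
    0 ≤ totalVariance P T l := by
  rw [totalVariance_eq]
  exact Finset.sum_nonneg fun t _ => varianceAt_nonneg P l t

lemma norm_mean_le_drift (P : Measure Ω) (l : ℕ → Ω → Fin K → ℝ) (n : ℕ) :
    ‖mean P l n‖ ≤ ∑ t ∈ Finset.Icc 1 n, ‖mean P l t - mean P l (t - 1)‖ := by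
  induction n with
  | zero => simp [mean]
  | succ n ih =>
    rw [Finset.sum_Icc_succ_top (by omega), Nat.add_sub_cancel]
    have h : mean P l (n + 1) = mean P l n + (mean P l (n + 1) - mean P l n) := by abel
    calc ‖mean P l (n + 1)‖ = ‖mean P l n + (mean P l (n + 1) - mean P l n)‖ := by rw [← h]
      _ ≤ _ := (norm_add_le _ _).trans (add_le_add_left ih _)

lemma norm_mean_le_totalDrift (P : Measure Ω) (l : ℕ → Ω → Fin K → ℝ) {t : ℕ} (ht : t ≤ T) :
    ‖mean P l t‖ ≤ totalDrift P T l :=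
  (norm_mean_le_drift P l t).trans (Finset.sum_le_sum_of_subset_of_nonneg
    (Finset.Icc_subset_Icc_right ht) fun _ _ _ => norm_nonneg _)

lemma totalDrift_nonneg (P : Measure Ω) (T : ℕ) (l : ℕ → Ω → Fin K → ℝ) :
    0 ≤ totalDrift P T l :=
  Finset.sum_nonneg fun _ _ => norm_nonneg _

section Prob

variable [IsProbabilityMeasure P]

lemma dynamicRegret_eq (h : IsEnvironment P T l) (ha : IsPlayOf P T l a) (hKT : 2 ≤ K * T) :
    dynamicRegret P T l a
      = ∑ t ∈ Finset.Icc 1 T, ((∫ ω, playedLoss T l t ω ∂P) - ⨅ i, mean P l t i) :=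
  Finset.sum_congr rfl fun t ht => by rw [integral_loss_play h ha hKT ht]

/-- In every round the expected loss is an average of the entries of `μ_t`, hence at most `V`, since
`μ_0 = 0`. -/
lemma dynamicRegret_le_drift_mul (h : IsEnvironment P T l) (ha : IsPlayOf P T l a)
    (hKT : 2 ≤ K * T) : dynamicRegret P T l a ≤ totalDrift P T l * T := by
  rw [dynamicRegret_eq h ha hKT]
  calc _ ≤ ∑ t ∈ Finset.Icc 1 T, totalDrift P T l := by
        refine Finset.sum_le_sum fun t ht => ?_
        have ht' := (Finset.mem_Icc.1 ht).2
        have h0 : 0 ≤ ⨅ i, mean P l t i := Real.iInf_nonneg fun i => (h.mean_mem_Icc ht' i).1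
        linarith [h.integral_playedLoss_le hKT ht, norm_mean_le_totalDrift P l ht']
    _ = _ := by simp [mul_comm]

lemma IsEnvironment.norm_mean_sub_le_one (h : IsEnvironment P T l) {t : ℕ} (ht : t ≤ T) :
    ‖mean P l t - mean P l (t - 1)‖ ≤ 1 :=
  norm_sub_le_one (h.mean_mem_Icc (by omega)) (h.mean_mem_Icc ht)

/-- Regret against an arbitrary sequence `κ` of arms, in terms of the number of pieces of `κ`. -/
theorem IsEnvironment.tracking_regret_le (h : IsEnvironment P T l) (hK : 2 ≤ K) (hT : 1 ≤ T)
    (κ : ℕ → Fin K) {G : ℝ}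
    (hG : (1 + ∑ t ∈ Finset.Icc 2 T, if κ t ≠ κ (t - 1) then (1 : ℝ) else 0) ≤ G) :
    ∑ t ∈ Finset.Icc 1 T, ((∫ ω, playedLoss T l t ω ∂P) - mean P l t (κ t))
      ≤ 600 * (1 + Real.log T) * (Real.sqrt (G * totalVariance P T l * Real.log K)
        + G * Real.log K + ∑ t ∈ Finset.Icc 1 T, ‖mean P l t - mean P l (t - 1)‖ ^ 2) := by
  have hlogK := half_le_log_of_two_le hK
  have hlT : 0 ≤ Real.log T := Real.log_natCast_nonneg T
  have hG1 : 1 ≤ G := by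
    refine le_trans ?_ hG
    have : 0 ≤ ∑ t ∈ Finset.Icc 2 T, if κ t ≠ κ (t - 1) then (1 : ℝ) else 0 :=
      Finset.sum_nonneg fun t _ => by split_ifs <;> norm_num
    linarith
  have hV0 := totalVariance_nonneg P T l
  have hD := h.sum_integral_sqChange_le
  have hQ0 : 0 ≤ ∑ t ∈ Finset.Icc 1 T, ‖mean P l t - mean P l (t - 1)‖ ^ 2 :=
    Finset.sum_nonneg fun _ _ => sq_nonneg _
  set Q := ∑ t ∈ Finset.Icc 1 T, ‖mean P l t - mean P l (t - 1)‖ ^ 2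
  set V := totalVariance P T l
  set R := ∑ t ∈ Finset.Icc 1 T, ((∫ ω, playedLoss T l t ω ∂P) - mean P l t (κ t)) with hR
  set M := 100 * (1 + Real.log T) with hM
  have hM0 : 0 < M := by positivity
  have hlam : ∀ lam : ℝ, 0 < lam → lam ≤ 1 →
      R / M ≤ lam * (6 * V + 3 * Q) + G * Real.log K / lam := by
    intro lam h0 h1
    have h2 := sum_le_of_interval_le hT
      (F := fun t k => (∫ ω, playedLoss T l t ω ∂P) - mean P l t k)
      (fun s n hs hsn hn k => h.interval_regret_le hK hT hs hsn hn k h0 h1) κ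
    rw [← Finset.mul_sum] at h2
    rw [div_le_iff₀ hM0]
    refine h2.trans ?_
    calc _ ≤ M * lam * (6 * V + 3 * Q) + G * (M * (Real.log K / lam)) := by
          gcongr
      _ = _ := by ring
  have h3 := le_of_forall_lam (by positivity) (by positivity) hlam
  -- `√((6 V + 3 Q) Y) ≤ 3 √(V Y) + 2 √(Q Y)` and `4 √(Q Y) ≤ 2 Q + 2 Y` for `Y = G ln K`.
  have hY : 0 ≤ G * Real.log K := by positivity
  set Y := G * Real.log K
  have h4 : Real.sqrt ((6 * V + 3 * Q) * Y) ≤ 3 * Real.sqrt (V * Y) + (Q + Y) := by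
    refine Real.sqrt_le_iff.2 ⟨by positivity, ?_⟩
    have h5 := Real.sq_sqrt (mul_nonneg hV0 hY)
    nlinarith [mul_nonneg (Real.sqrt_nonneg (V * Y)) (add_nonneg hQ0 hY), sq_nonneg (Q - Y),
      mul_nonneg hV0 hY]
  have h6 : G * V * Real.log K = V * Y := by ring
  rw [h6]
  rw [div_le_iff₀ hM0] at h3
  have h7 : 2 * Real.sqrt ((6 * V + 3 * Q) * Y) + Y ≤ 6 * (Real.sqrt (V * Y) + Y + Q) := by
    linarith
  calc R ≤ (2 * Real.sqrt ((6 * V + 3 * Q) * Y) + Y) * M := h3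
    _ ≤ 6 * (Real.sqrt (V * Y) + Y + Q) * M := by gcongr
    _ = _ := by rw [hM]; ring

/-- The bound in terms of `Γ`: the best arm changes only when the mean vector does. -/
theorem dynamicRegret_le_numSwitch (h : IsEnvironment P T l) (ha : IsPlayOf P T l a) (hK : 2 ≤ K)
    (hT : 1 ≤ T) :
    dynamicRegret P T l a ≤ 1800 * (1 + Real.log T)
      * (Real.sqrt (numSwitch P T l * totalVariance P T l * Real.log K)
        + numSwitch P T l * Real.log K) := by
  classical
  have hKT : 2 ≤ K * T := hK.trans (Nat.le_mul_of_pos_right K hT)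
  obtain ⟨f, hf⟩ := exists_argmin (K := K) (by omega)
  have hG : (1 + ∑ t ∈ Finset.Icc 2 T,
      if f (mean P l t) ≠ f (mean P l (t - 1)) then (1 : ℝ) else 0) ≤ numSwitch P T l := by
    unfold numSwitch
    gcongr with t ht
    by_cases hm : mean P l t = mean P l (t - 1)
    · simp [hm]
    · rw [if_pos hm]
      split_ifs <;> norm_num
  have hQ : ∑ t ∈ Finset.Icc 1 T, ‖mean P l t - mean P l (t - 1)‖ ^ 2 ≤ numSwitch P T l := by
    have hone : ∀ t ∈ Finset.Icc 1 T, ‖mean P l t - mean P l (t - 1)‖ ^ 2 ≤ 1 := fun t ht =>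
      pow_le_one₀ (norm_nonneg _) (h.norm_mean_sub_le_one (Finset.mem_Icc.1 ht).2)
    rw [← Finset.add_sum_Ioc_eq_sum_Icc hT]
    unfold numSwitch
    refine add_le_add (hone 1 (Finset.mem_Icc.2 ⟨le_rfl, hT⟩)) ?_
    refine Finset.sum_le_sum fun t ht => ?_
    by_cases hm : mean P l t = mean P l (t - 1)
    · simp [hm]
    · rw [if_pos hm]
      exact hone t (Finset.Ioc_subset_Icc_self ht)
  have h1 := h.tracking_regret_le hK hT (fun t => f (mean P l t)) hG
  have h2 : dynamicRegret P T l a = ∑ t ∈ Finset.Icc 1 T,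
      ((∫ ω, playedLoss T l t ω ∂P) - mean P l t (f (mean P l t))) := by
    rw [dynamicRegret_eq h ha hKT]
    exact Finset.sum_congr rfl fun t _ => by rw [hf (mean P l t)]
  rw [h2]
  refine h1.trans ?_
  have hlogK := half_le_log_of_two_le hK
  have hlT : 0 ≤ Real.log T := Real.log_natCast_nonneg T
  have hΓ : 0 ≤ numSwitch P T l := by
    refine le_trans ?_ hQ
    exact Finset.sum_nonneg fun _ _ => sq_nonneg _
  have h3 := Real.sqrt_nonneg (numSwitch P T l * totalVariance P T l * Real.log K)
  have h4 : numSwitch P T l ≤ 2 * (numSwitch P T l * Real.log K) := by nlinarith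
  calc _ ≤ 600 * (1 + Real.log T)
        * (3 * (Real.sqrt (numSwitch P T l * totalVariance P T l * Real.log K)
          + numSwitch P T l * Real.log K)) := by
        gcongr
        linarith
    _ = _ := by ring

/-! ### Blocks of equal length -/

/-- A monotone sequence of natural numbers has at most as many jumps as its final value. -/
lemma sum_ite_ne_le_of_monotone {q : ℕ → ℕ} (hq : Monotone q) (n : ℕ) :
    ∑ t ∈ Finset.Icc 2 n, (if q t ≠ q (t - 1) then (1 : ℝ) else 0) ≤ q n := by
  induction n with
  | zero => simp
  | succ n ih =>
    rcases Nat.lt_or_ge (n + 1) 2 with hn | hn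
    · rw [Finset.Icc_eq_empty (by omega), Finset.sum_empty]
      positivity
    · rw [Finset.sum_Icc_succ_top hn, Nat.add_sub_cancel]
      have hle : q n ≤ q (n + 1) := hq (Nat.le_succ n)
      by_cases heq : q (n + 1) = q n
      · simpa [heq] using ih
      · rw [if_pos heq]
        have : q n + 1 ≤ q (n + 1) := by omega
        have : (q n : ℝ) + 1 ≤ q (n + 1) := by exact_mod_cast this
        linarith

lemma norm_mean_sub_mean_le (P : Measure Ω) (l : ℕ → Ω → Fin K → ℝ) (t i : ℕ) :
    ‖mean P l t - mean P l (t - i)‖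
      ≤ ∑ j ∈ Finset.range i, ‖mean P l (t - j) - mean P l (t - j - 1)‖ := by
  induction i with
  | zero => simp
  | succ i ih =>
    rw [Finset.sum_range_succ, ← Nat.sub_sub t i 1]
    refine le_trans ?_ (add_le_add_left ih _)
    exact norm_sub_le_norm_sub_add_norm_sub _ _ _

/-- Every drift term is counted at most once for each offset `j < L` within a block. -/
lemma sum_sum_drift_le (P : Measure Ω) (T : ℕ) (l : ℕ → Ω → Fin K → ℝ) (L : ℕ) :
    ∑ t ∈ Finset.Icc 1 T, ∑ j ∈ Finset.range L, ‖mean P l (t - j) - mean P l (t - j - 1)‖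
      ≤ L * totalDrift P T l := by
  have hshift : ∀ n j, ∑ t ∈ Finset.Icc 1 n, ‖mean P l (t - j) - mean P l (t - j - 1)‖
      = ∑ t ∈ Finset.Icc 1 (n - j), ‖mean P l t - mean P l (t - 1)‖ := by
    intro n j
    induction n with
    | zero => simp
    | succ n ih =>
      rw [Finset.sum_Icc_succ_top (by omega), ih]
      rcases Nat.lt_or_ge n j with hn | hn
      · simp [Nat.sub_eq_zero_of_le hn.le, Nat.sub_eq_zero_of_le (show n + 1 ≤ j from hn)]
      · rw [Nat.sub_add_comm hn, Finset.sum_Icc_succ_top (by omega)]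
  rw [Finset.sum_comm]
  calc _ ≤ ∑ j ∈ Finset.range L, totalDrift P T l := by
        refine Finset.sum_le_sum fun j _ => ?_
        rw [hshift]
        exact Finset.sum_le_sum_of_subset_of_nonneg (Finset.Icc_subset_Icc_right (by omega))
          fun _ _ _ => norm_nonneg _
    _ = _ := by simp

/-- Comparing with the arm that is best at the start of each block of length `L`. -/
lemma dynamicRegret_le_of_blockLength (h : IsEnvironment P T l) (ha : IsPlayOf P T l a)
    (hK : 2 ≤ K) (hT : 1 ≤ T) {L : ℕ} (hL : 1 ≤ L) {G : ℝ} (hG : 1 + (T : ℝ) / L ≤ G) :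
    dynamicRegret P T l a ≤ 600 * (1 + Real.log T)
      * (Real.sqrt (G * totalVariance P T l * Real.log K) + G * Real.log K + totalDrift P T l)
      + 2 * (L * totalDrift P T l) := by
  have hKT : 2 ≤ K * T := hK.trans (Nat.le_mul_of_pos_right K hT)
  obtain ⟨f, hf⟩ := exists_argmin (K := K) (by omega)
  -- Round `t` belongs to the block that starts with round `t - (t - 1) % L`.
  let q : ℕ → ℕ := fun t => (t - 1) / L
  let κ : ℕ → Fin K := fun t => f (mean P l (L * q t + 1))
  have hG' : (1 + ∑ t ∈ Finset.Icc 2 T, if κ t ≠ κ (t - 1) then (1 : ℝ) else 0) ≤ G := by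
    refine le_trans (add_le_add_right ?_ 1) hG
    have hmono : Monotone q := fun s t hst => Nat.div_le_div_right (by omega)
    calc _ ≤ ∑ t ∈ Finset.Icc 2 T, (if q t ≠ q (t - 1) then (1 : ℝ) else 0) := by
          refine Finset.sum_le_sum fun t _ => ?_
          by_cases hqt : q t = q (t - 1)
          · simp [κ, hqt]
          · rw [if_pos hqt]
            split_ifs <;> norm_num
      _ ≤ q T := sum_ite_ne_le_of_monotone hmono T
      _ ≤ (((T - 1 : ℕ) : ℝ)) / L := Nat.cast_div_le
      _ ≤ _ := by
        gcongr
        omega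
  have hQ : ∑ t ∈ Finset.Icc 1 T, ‖mean P l t - mean P l (t - 1)‖ ^ 2 ≤ totalDrift P T l := by
    refine Finset.sum_le_sum fun t ht => ?_
    have := h.norm_mean_sub_le_one (Finset.mem_Icc.1 ht).2
    exact pow_le_of_le_one (norm_nonneg _) this (by norm_num)
  have h1 := h.tracking_regret_le hK hT κ hG'
  have h2 : ∀ t ∈ Finset.Icc 1 T, mean P l t (κ t) - ⨅ i, mean P l t i
      ≤ 2 * ∑ j ∈ Finset.range L, ‖mean P l (t - j) - mean P l (t - j - 1)‖ := by
    intro t ht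
    have ht1 := (Finset.mem_Icc.1 ht).1
    have hmod : L * q t + 1 = t - (t - 1) % L := by
      have := Nat.div_add_mod (t - 1) L
      change L * ((t - 1) / L) + 1 = _
      omega
    have h3 : ‖mean P l t - mean P l (L * q t + 1)‖
        ≤ ∑ j ∈ Finset.range L, ‖mean P l (t - j) - mean P l (t - j - 1)‖ := by
      rw [hmod]
      refine (norm_mean_sub_mean_le P l t _).trans ?_
      exact Finset.sum_le_sum_of_subset_of_nonneg
        (Finset.range_mono (Nat.mod_lt _ hL).le) fun _ _ _ => norm_nonneg _
    set ν := mean P l (L * q t + 1)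
    have h4 : ∀ i, |mean P l t i - ν i| ≤ ‖mean P l t - ν‖ := fun i =>
      norm_le_pi_norm (mean P l t - ν) i
    rw [← hf (mean P l t)]
    have h5 : ν (κ t) ≤ ν (f (mean P l t)) := by
      change ν (f ν) ≤ _
      rw [hf ν]
      exact ciInf_le (Set.finite_range _).bddBelow _
    have h6 := abs_le.1 (h4 (κ t))
    have h7 := abs_le.1 (h4 (f (mean P l t)))
    linarith
  have h8 := sum_sum_drift_le P T l L
  have hsum : dynamicRegret P T l a
      = ∑ t ∈ Finset.Icc 1 T, ((∫ ω, playedLoss T l t ω ∂P) - mean P l t (κ t))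
        + ∑ t ∈ Finset.Icc 1 T, (mean P l t (κ t) - ⨅ i, mean P l t i) := by
    rw [dynamicRegret_eq h ha hKT, ← Finset.sum_add_distrib]
    exact Finset.sum_congr rfl fun t _ => by ring
  have h9 := Finset.sum_le_sum h2
  rw [← Finset.mul_sum] at h9
  have hlT : 0 ≤ Real.log T := Real.log_natCast_nonneg T
  rw [hsum]
  refine add_le_add (h1.trans ?_) (h9.trans (by linarith))
  gcongr

/-- The bound in terms of `V`. With `h` the sum of the two terms, blocks of length about `h / V`
make all contributions of order `h`; if this length exceeds `T`, the trivial bound `V T` is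
smaller than `h`. -/
theorem dynamicRegret_le_totalDrift (h : IsEnvironment P T l) (ha : IsPlayOf P T l a) (hK : 2 ≤ K)
    (hT : 1 ≤ T) :
    dynamicRegret P T l a ≤ 4800 * (1 + Real.log T)
      * ((totalDrift P T l * totalVariance P T l * T * Real.log K) ^ (1 / 3 : ℝ)
        + Real.sqrt (totalDrift P T l * T * Real.log K)) := by
  have hKT : 2 ≤ K * T := hK.trans (Nat.le_mul_of_pos_right K hT)
  have htriv := dynamicRegret_le_drift_mul h ha hKT
  have hblock := fun (L : ℕ) (hL : 1 ≤ L) (G : ℝ) (hG : 1 + (T : ℝ) / L ≤ G) =>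
    dynamicRegret_le_of_blockLength h ha hK hT hL hG
  have hlogK := half_le_log_of_two_le hK
  have hlT : 0 ≤ Real.log T := Real.log_natCast_nonneg T
  have hV0 := totalDrift_nonneg P T l
  have hΛ0 := totalVariance_nonneg P T l
  have hVT : totalDrift P T l ≤ T := by
    calc totalDrift P T l ≤ ∑ t ∈ Finset.Icc 1 T, (1 : ℝ) :=
          Finset.sum_le_sum fun t ht => h.norm_mean_sub_le_one (Finset.mem_Icc.1 ht).2
      _ = T := by simp
  have hT1 : (1 : ℝ) ≤ T := by exact_mod_cast hT
  set V := totalDrift P T l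
  set Λ := totalVariance P T l
  set R := dynamicRegret P T l a
  set k := Real.log K
  set M := 1 + Real.log T
  have hM : 1 ≤ M := by simpa [M] using hlT
  have hA0 : 0 ≤ (V * Λ * T * k) ^ (1 / 3 : ℝ) := by positivity
  have hA3 : ((V * Λ * T * k) ^ (1 / 3 : ℝ)) ^ 3 = V * Λ * T * k := by
    rw [← Real.rpow_natCast, ← Real.rpow_mul (by positivity)]
    norm_num
  have hB0 : 0 ≤ Real.sqrt (V * T * k) := Real.sqrt_nonneg _
  have hB2 : Real.sqrt (V * T * k) ^ 2 = V * T * k := Real.sq_sqrt (by positivity)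
  rcases hV0.eq_or_lt with hV | hV
  · refine htriv.trans ?_
    rw [← hV]
    simp
  have hBpos : 0 < Real.sqrt (V * T * k) := Real.sqrt_pos.2 (by positivity)
  set A := (V * Λ * T * k) ^ (1 / 3 : ℝ)
  set B := Real.sqrt (V * T * k)
  have hx : 0 < A + B := by linarith
  have hAx : A ≤ A + B := by linarith
  have hBx : B ≤ A + B := by linarith
  set x := A + B
  have hMx : x ≤ M * x := le_mul_of_one_le_left hx.le hM
  rcases lt_or_ge (V * T) x with hg | hg
  · linarith
  -- The block length is `⌈x / V⌉`, and there are at most `1 + V T / x ≤ 2 V T / x` blocks.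
  have hL1 : 1 ≤ ⌈x / V⌉₊ := Nat.one_le_ceil_iff.2 (by positivity)
  have hLge : x / V ≤ ⌈x / V⌉₊ := Nat.le_ceil _
  have hLle : (⌈x / V⌉₊ : ℝ) ≤ x / V + 1 := (Nat.ceil_lt_add_one (by positivity)).le
  have hG : 1 + (T : ℝ) / ⌈x / V⌉₊ ≤ 2 * (V * T / x) := by
    have h1 : (T : ℝ) / ⌈x / V⌉₊ ≤ V * T / x := by
      calc (T : ℝ) / ⌈x / V⌉₊ ≤ T / (x / V) := by gcongr
        _ = _ := by field_simp
    have h2 : 1 ≤ V * T / x := (one_le_div hx).2 hg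
    linarith
  have h1 := hblock _ hL1 _ hG
  have h2 : Real.sqrt (2 * (V * T / x) * Λ * k) ≤ 2 * x := by
    refine Real.sqrt_le_iff.2 ⟨by positivity, ?_⟩
    have h3 : 2 * (V * T / x) * Λ * k = 2 * (A ^ 3 / x) := by rw [hA3]; ring
    have h4 : A ^ 3 / x ≤ x ^ 2 := by
      rw [div_le_iff₀ hx]
      calc A ^ 3 ≤ x ^ 3 := by gcongr
        _ = _ := by ring
    rw [h3]
    nlinarith
  have h5 : 2 * (V * T / x) * k ≤ 2 * x := by
    have h3 : 2 * (V * T / x) * k = 2 * (B ^ 2 / x) := by rw [hB2]; ring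
    have h4 : B ^ 2 / x ≤ x := by
      rw [div_le_iff₀ hx]
      calc B ^ 2 ≤ x ^ 2 := by gcongr
        _ = _ := by ring
    linarith
  have h6 : V ≤ 2 * x := by
    have h7 : V ≤ 2 * B := by
      refine abs_le_of_sq_le_sq' ?_ (by positivity) |>.2
      rw [mul_pow, hB2]
      nlinarith [mul_le_mul_of_nonneg_left hVT hV.le,
        mul_nonneg (mul_nonneg hV.le (by linarith : (0 : ℝ) ≤ T)) (sub_nonneg.2 hlogK)]
    linarith
  have h8 : (⌈x / V⌉₊ : ℝ) * V ≤ 3 * x := by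
    calc (⌈x / V⌉₊ : ℝ) * V ≤ (x / V + 1) * V := by gcongr
      _ = x + V := by field_simp
      _ ≤ _ := by linarith
  calc R ≤ 600 * M * (2 * x + 2 * x + 2 * x) + 2 * (3 * x) := by
        refine h1.trans ?_
        gcongr
    _ ≤ _ := by nlinarith

end Prob

/-- With a single arm there is nothing to choose. -/
lemma dynamicRegret_one_arm (P : Measure Ω) (T : ℕ) (l : ℕ → Ω → Fin 1 → ℝ) (a : ℕ → Ω → Fin 1) :
    dynamicRegret P T l a = 0 := by
  refine Finset.sum_eq_zero fun t ht => ?_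
  have h : ∀ ω, a t ω = 0 := fun ω => Subsingleton.elim _ _
  simp_rw [h]
  rw [ciInf_unique, mean_of_pos P l (Finset.mem_Icc.1 ht).1]
  exact sub_self _

end Comparators

end NonstationaryExperts

end

theorem mainTheorem5 :
    ∃ (C : ℝ) (d : ℕ), 0 < C ∧
      ∀ (K T : ℕ), 1 ≤ K → 2 ≤ K * T →
      ∀ (Ω : Type*) [MeasurableSpace Ω] (P : MeasureTheory.Measure Ω)
        [MeasureTheory.IsProbabilityMeasure P]
        (l : ℕ → Ω → Fin K → ℝ) (a : ℕ → Ω → Fin K),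
        NonstationaryExperts.IsEnvironment P T l →
        NonstationaryExperts.IsPlayOf P T l a →
        NonstationaryExperts.dynamicRegret P T l a ≤
            C * (1 + Real.log T) ^ d *
              (Real.sqrt (NonstationaryExperts.numSwitch P T l
                  * NonstationaryExperts.totalVariance P T l * Real.log K)
                + NonstationaryExperts.numSwitch P T l * Real.log K) ∧
        NonstationaryExperts.dynamicRegret P T l a ≤
            C * (1 + Real.log T) ^ d *
              ((NonstationaryExperts.totalDrift P T l
                  * NonstationaryExperts.totalVariance P T l * T * Real.log K) ^ (1 / 3 : ℝ)
                + Real.sqrt (NonstationaryExperts.totalDrift P T l * T * Real.log K)) := by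
  refine ⟨4800, 1, by norm_num, fun K T hK hKT Ω _ P _ l a hl ha => ?_⟩
  have hT : 1 ≤ T := Nat.pos_of_mul_pos_left (by omega : 0 < K * T)
  rw [pow_one]
  rcases hK.eq_or_lt with rfl | hK2
  · rw [NonstationaryExperts.dynamicRegret_one_arm]
    simp
  · refine ⟨(NonstationaryExperts.dynamicRegret_le_numSwitch hl ha hK2 hT).trans ?_,
      NonstationaryExperts.dynamicRegret_le_totalDrift hl ha hK2 hT⟩
    have hlT : 0 ≤ Real.log T := Real.log_natCast_nonneg T
    have hlK : 0 ≤ Real.log K := Real.log_natCast_nonneg K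
    have hΓ : 0 ≤ NonstationaryExperts.numSwitch P T l :=
      add_nonneg zero_le_one (Finset.sum_nonneg fun t _ => by split_ifs <;> norm_num)
    gcongr
    norm_num
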